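/- **Setting.** Let $O(1)=\{\pm1\}$ and let $\mathbf P=BO(1)$ be the corresponding one-object groupoid. Let $\mathcal Z$ be the 2-category of finite groupoids with parity structure. Its objects are groupoids $X$ with finitely many isomorphism classes and finite hom-sets, equipped with a functor $X\to\mathbf P$. Its morphisms are functors $u$ together with a natural isomorphism filling the triangle over $\mathbf P$. Its 2-cells are natural isomorphisms compatible with these triangles. A *linear functor* $\mathcal Z_{/S}\to\mathcal Z_{/T}$ is a $\mathbf P$-span $S\leftarrow M\to T$, that is, a span in $\mathcal Z$. Linear functors are composed by homotopy pullback. A morphism of spans is a morphism of apices with 2-cells (in $\mathcal Z$) comparing the legs; it is an equivalence if its underlying functor is one. For $X\in\mathcal Z$ and $k\in\mathbb N$, let $X^k$ be the groupoid of $k$-tuples, where the parity of a tuple of arrows is the product of the parities; thus $\mathcal Z_{/X}\circledast\cdots\circledast\mathcal Z_{/X}=\mathcal Z_{/X^k}$. The symmetric group $\Sigma_k$ acts on $X^k$ by permuting the factors, the 2-cell of $\sigma$ over $\mathbf P$ being constantly $\operatorname{sign}(\sigma)$ (the *signed action*). Let $\Lambda^kX:=X^k/\Sigma_k$ be the weak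 quotient of this action in $\mathcal Z$: an arrow $(y_j)\to(x_j)$ is a permutation $\sigma$ with arrows $\gamma_j:y_j\to x_{\sigma(j)}$, of parity $\operatorname{sign}(\sigma)\prod_j\operatorname{par}(\gamma_j)$. Let $q:X^k\to\Lambda^kX$ be the quotient map, put $\Lambda^k(\mathcal Z_{/X}):=\mathcal Z_{/\Lambda^kX}$, and let $q_!$ be the linear functor given by the span $X^k\xleftarrow{=}X^k\xrightarrow{q}\Lambda^kX$. An *alternating linear functor* $\mathcal Z_{/X}\circledast\cdots\circledast\mathcal Z_{/X}\to\mathcal Z_{/W}$ is a $\mathbf P$-span $X^k\xleftarrow{s}A\xrightarrow{t}W$ equipped with a compatible system of 2-cells for the signed action. Explicitly, it is equipped with an action of $\Sigma_k$ on $A$ in $\mathcal Z$ (strict, or more generally with coherent 2-cells $a\cong a.1$, $(a.\sigma).\tau\cong a.(\sigma\tau)$), 2-cells $s(a.\sigma)\cong s(a).\sigma$, and 2-cells $\alpha_\sigma:t(a.\sigma)\cong t(a)$, all in $\mathcal Z$ and compatible with unit and composition in $\Sigma_k$. Morphisms of alternating linear functors are morphisms of spans with coherent equivariance 2-cells compatible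 with these data. The 2-cells between them are 2-cells between the maps of apices, compatible with all the 2-cells just mentioned. If $Q:\mathcal Z_{/X}\circledast\cdots\circledast\mathcal Z_{/X}\to\mathcal Z_{/Y}$ is alternating and $u:\mathcal Z_{/Y}\to\mathcal Z_{/W}$ is linear, then $u\circ Q$ is alternating by whiskering. **Proposition.** The functor $q_!:\mathcal Z_{/X}\circledast\cdots\circledast\mathcal Z_{/X}\to\Lambda^k(\mathcal Z_{/X})$, with the 2-cells given by the arrows $x.\sigma\to x$ of $\Lambda^kX$, is the universal alternating linear functor. That is, let $F:\mathcal Z_{/X}\circledast\cdots\circledast\mathcal Z_{/X}\to\mathcal Z_{/W}$ be any alternating linear functor, given by $X^k\xleftarrow{s}A\xrightarrow{t}W$. Then: 1. There are a linear functor $u:\Lambda^k(\mathcal Z_{/X})\to\mathcal Z_{/W}$ and an equivalence $F\simeq u\circ q_!$ of alternating linear functors. 2. This factorization is unique up to contractible choice: for two factorizations $(u,F\simeq u\circ q_!)$ and $(u',F\simeq u'\circ q_!)$ there is an equivalence of spans $u\simeq u'$ together with a 2-cell making it compatible with the two equivalences from $F$, and any two such compatible equivalences are related by a unique compatible 2-cell.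 3. The factoring span can be taken to be $\Lambda^kX\xleftarrow{\bar s}A/\Sigma_k\xrightarrow{\bar t}W$, where $A/\Sigma_k$ is the weak quotient in $\mathcal Z$ and $\bar s,\bar t$ are induced by $s,t$ and their 2-cells. The equivalence $A\simeq X^k\times_{\Lambda^kX}A/\Sigma_k$ can be chosen so that its second projection is, up to a 2-cell, the quotient map $A\to A/\Sigma_k$. -/

import Mathlib

open CategoryTheory

universe u

namespace ParityLin

/-- The one-object groupoid `P = BO(1)`, where `O(1) = {+1, -1}`. -/
abbrev Parity : Type := SingleObj ℤˣ

/-- A finite groupoid (finitely many isomorphism classes, finite hom-sets) equipped with a parity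
structure, that is, a functor to `P`. -/
structure ParityGroupoid : Type (u + 1) where
  carrier : Type u
  [groupoid : Groupoid.{u} carrier]
  par : carrier ⥤ Parity
  finite_components : Finite (Quotient (isIsomorphicSetoid carrier))
  finite_hom : ∀ x y : carrier, Finite (x ⟶ y)

namespace ParityGroupoid

attribute [instance] ParityGroupoid.groupoid ParityGroupoid.finite_components
  ParityGroupoid.finite_hom

/-- A morphism of parity groupoids: a functor together with a natural transformation
(automatically invertible) filling the triangle over `P`. -/
structure Hom (X Y : ParityGroupoid.{u}) : Type u where
  func : X.carrier ⥤ Y.carrier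
  cell : X.par ⟶ func ⋙ Y.par

/-- A 2-cell between morphisms of parity groupoids: a natural transformation
(automatically invertible) compatible with the triangles over `P`. -/
structure Hom₂ {X Y : ParityGroupoid.{u}} (F G : Hom X Y) : Type u where
  nat : F.func ⟶ G.func
  compat : ∀ x, F.cell.app x ≫ Y.par.map (nat.app x) = G.cell.app x

@[ext]
theorem Hom₂.ext' {X Y : ParityGroupoid.{u}} {F G : Hom X Y} {a b : Hom₂ F G}
    (h : ∀ x, a.nat.app x = b.nat.app x) : a = b := by
  cases a; cases b
  congr 1
  ext x
  exact h x

instance : CategoryStruct ParityGroupoid.{u} where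
  Hom := Hom
  id X := { func := 𝟭 _, cell := { app := fun _ => 𝟙 _ } }
  comp F G :=
    { func := F.func ⋙ G.func
      cell := { app := fun x => F.cell.app x ≫ G.cell.app (F.func.obj x) } }

section simpLemmas

variable {X Y Z : ParityGroupoid.{u}} (F : X ⟶ Y) (G : Y ⟶ Z)

@[simp] theorem id_func_obj (x : X.carrier) : (𝟙 X : X ⟶ X).func.obj x = x := rfl

@[simp] theorem id_func_map {x y : X.carrier} (f : x ⟶ y) :
    (𝟙 X : X ⟶ X).func.map f = f := rfl

@[simp] theorem id_cell_app (x : X.carrier) :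
    (𝟙 X : X ⟶ X).cell.app x = 𝟙 (X.par.obj x) := rfl

@[simp] theorem comp_func_obj (x : X.carrier) :
    (F ≫ G).func.obj x = G.func.obj (F.func.obj x) := rfl

@[simp] theorem comp_func_map {x y : X.carrier} (f : x ⟶ y) :
    (F ≫ G).func.map f = G.func.map (F.func.map f) := rfl

@[simp] theorem comp_cell_app (x : X.carrier) :
    (F ≫ G).cell.app x = F.cell.app x ≫ G.cell.app (F.func.obj x) := rfl

end simpLemmas

instance homCategory (X Y : ParityGroupoid.{u}) : Category (X ⟶ Y) where
  Hom F G := Hom₂ F G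
  id F := { nat := 𝟙 _, compat := by simp }
  comp a b :=
    { nat := a.nat ≫ b.nat
      compat := fun x => by simp [← b.compat, ← a.compat] }

@[simp] theorem id_nat_app {X Y : ParityGroupoid.{u}} (F : X ⟶ Y) (x : X.carrier) :
    (𝟙 F : F ⟶ F).nat.app x = 𝟙 (F.func.obj x) := rfl

@[simp] theorem comp_nat_app {X Y : ParityGroupoid.{u}} {F G H : X ⟶ Y} (a : F ⟶ G) (b : G ⟶ H)
    (x : X.carrier) : (a ≫ b).nat.app x = a.nat.app x ≫ b.nat.app x := rfl

@[ext]
theorem hom₂_ext {X Y : ParityGroupoid.{u}} {F G : X ⟶ Y} {a b : F ⟶ G}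
    (h : ∀ x, a.nat.app x = b.nat.app x) : a = b :=
  Hom₂.ext' h

@[simp]
theorem nat_naturality {X Y : ParityGroupoid.{u}} {F G : X ⟶ Y} (a : F ⟶ G)
    {x y : X.carrier} (f : x ⟶ y) :
    F.func.map f ≫ a.nat.app y = a.nat.app x ≫ G.func.map f :=
  a.nat.naturality f

@[simp]
theorem nat_naturality_assoc {X Y : ParityGroupoid.{u}} {F G : X ⟶ Y} (a : F ⟶ G)
    {x y : X.carrier} (f : x ⟶ y) {z : Y.carrier} (h : G.func.obj y ⟶ z) :
    F.func.map f ≫ a.nat.app y ≫ h = a.nat.app x ≫ G.func.map f ≫ h :=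
  a.nat.naturality_assoc f h

theorem cell_naturality {X Y : ParityGroupoid.{u}} (F : X ⟶ Y) {x y : X.carrier} (f : x ⟶ y) :
    X.par.map f ≫ F.cell.app y = F.cell.app x ≫ Y.par.map (F.func.map f) :=
  F.cell.naturality f

theorem cell_naturality_assoc {X Y : ParityGroupoid.{u}} (F : X ⟶ Y) {x y : X.carrier}
    (f : x ⟶ y) {p : Parity} (h : Y.par.obj (F.func.obj y) ⟶ p) :
    X.par.map f ≫ F.cell.app y ≫ h = F.cell.app x ≫ Y.par.map (F.func.map f) ≫ h :=
  F.cell.naturality_assoc f h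

theorem nat_compat {X Y : ParityGroupoid.{u}} {F G : X ⟶ Y} (a : F ⟶ G) (x : X.carrier) :
    F.cell.app x ≫ Y.par.map (a.nat.app x) = G.cell.app x :=
  a.compat x

theorem nat_compat_assoc {X Y : ParityGroupoid.{u}} {F G : X ⟶ Y} (a : F ⟶ G) (x : X.carrier)
    {p : Parity} (h : Y.par.obj (G.func.obj x) ⟶ p) :
    F.cell.app x ≫ Y.par.map (a.nat.app x) ≫ h = G.cell.app x ≫ h := by
  rw [← nat_compat a x, Category.assoc]

/-- Constructor for 2-cells from components. -/
def mkCell {X Y : ParityGroupoid.{u}} {F G : X ⟶ Y}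
    (app : ∀ x, F.func.obj x ⟶ G.func.obj x)
    (naturality : ∀ {x y : X.carrier} (f : x ⟶ y),
      F.func.map f ≫ app y = app x ≫ G.func.map f)
    (compat : ∀ x, F.cell.app x ≫ Y.par.map (app x) = G.cell.app x) : F ⟶ G :=
  Hom₂.mk { app := app, naturality := fun _ _ f => naturality f } compat

@[simp] theorem mkCell_nat_app {X Y : ParityGroupoid.{u}} {F G : X ⟶ Y}
    (app : ∀ x, F.func.obj x ⟶ G.func.obj x)
    (naturality : ∀ {x y : X.carrier} (f : x ⟶ y),
      F.func.map f ≫ app y = app x ≫ G.func.map f)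
    (compat : ∀ x, F.cell.app x ≫ Y.par.map (app x) = G.cell.app x) (x : X.carrier) :
    (mkCell app naturality compat).nat.app x = app x := rfl

/-- Left whiskering of a 2-cell. -/
def whiskL {X Y Z : ParityGroupoid.{u}} (F : X ⟶ Y) {G H : Y ⟶ Z} (η : G ⟶ H) :
    F ≫ G ⟶ F ≫ H :=
  mkCell (fun x => η.nat.app (F.func.obj x)) (fun f => by simp) (fun x => by simp [nat_compat])

/-- Right whiskering of a 2-cell. -/
def whiskR {X Y Z : ParityGroupoid.{u}} {F G : X ⟶ Y} (η : F ⟶ G) (H : Y ⟶ Z) :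
    F ≫ H ⟶ G ≫ H :=
  mkCell (fun x => H.func.map (η.nat.app x))
    (fun f => by simp [← Functor.map_comp])
    (fun x => by
      simp only [comp_cell_app, Category.assoc]
      erw [← cell_naturality, nat_compat_assoc])

@[simp] theorem whiskL_nat_app {X Y Z : ParityGroupoid.{u}} (F : X ⟶ Y) {G H : Y ⟶ Z}
    (η : G ⟶ H) (x : X.carrier) : (whiskL F η).nat.app x = η.nat.app (F.func.obj x) := rfl

@[simp] theorem whiskR_nat_app {X Y Z : ParityGroupoid.{u}} {F G : X ⟶ Y} (η : F ⟶ G)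
    (H : Y ⟶ Z) (x : X.carrier) : (whiskR η H).nat.app x = H.func.map (η.nat.app x) := rfl

/-- The 2-category of finite groupoids with parity structure. All its 2-cells are invertible. -/
instance : Bicategory ParityGroupoid.{u} where
  homCategory := homCategory
  whiskerLeft F _ _ η := whiskL F η
  whiskerRight η H := whiskR η H
  associator F G H :=
    { hom := mkCell (F := (F ≫ G) ≫ H) (G := F ≫ G ≫ H) (fun x => 𝟙 _)
        (fun f => by simp) (fun x => by simp)
      inv := mkCell (G := (F ≫ G) ≫ H) (F := F ≫ G ≫ H) (fun x => 𝟙 _)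
        (fun f => by simp) (fun x => by simp) }
  leftUnitor F :=
    { hom := mkCell (F := 𝟙 _ ≫ F) (G := F) (fun x => 𝟙 _) (fun f => by simp) (fun x => by simp)
      inv := mkCell (F := F) (G := 𝟙 _ ≫ F) (fun x => 𝟙 _) (fun f => by simp) (fun x => by simp) }
  rightUnitor F :=
    { hom := mkCell (F := F ≫ 𝟙 _) (G := F) (fun x => 𝟙 _) (fun f => by simp) (fun x => by simp)
      inv := mkCell (F := F) (G := F ≫ 𝟙 _) (fun x => 𝟙 _) (fun f => by simp) (fun x => by simp) }

/-- The parity, even (`1`) or odd (`-1`), of an arrow of a parity groupoid. -/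
def parity (X : ParityGroupoid.{u}) {x y : X.carrier} (f : x ⟶ y) : ℤˣ := X.par.map f

theorem parity_id (X : ParityGroupoid.{u}) (x : X.carrier) : X.parity (𝟙 x) = 1 :=
  X.par.map_id x

theorem parity_comp (X : ParityGroupoid.{u}) {x y z : X.carrier} (f : x ⟶ y) (g : y ⟶ z) :
    X.parity (f ≫ g) = X.parity f * X.parity g :=
  (X.par.map_comp f g).trans (mul_comm (X.parity g) (X.parity f))

theorem out_iso {C : Type u} [Groupoid.{u} C] (c : C) :
    Nonempty ((Quotient.mk (isIsomorphicSetoid C) c).out ≅ c) :=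
  Quotient.exact (s := isIsomorphicSetoid C) (Quotient.out_eq _)

/-- The `k`-fold convolution power `X * ⋯ * X`: the groupoid of `k`-tuples, the parity of a tuple
of arrows being the product of the parities. -/
def power (X : ParityGroupoid.{u}) (k : ℕ) : ParityGroupoid.{u} where
  carrier := Fin k → X.carrier
  par :=
    { obj := fun _ => SingleObj.star ℤˣ
      map := fun γ => (∏ i, X.parity (γ i) : ℤˣ)
      map_id := fun x => by
        change (∏ i, X.parity (𝟙 (x i))) = 1
        simp [parity_id]
      map_comp := fun f g => by
        change (∏ i, X.parity (f i ≫ g i)) = (∏ i, X.parity (g i)) * ∏ i, X.parity (f i)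
        simp [parity_comp, Finset.prod_mul_distrib, mul_comm] }
  finite_components := by
    let f : (Fin k → Quotient (isIsomorphicSetoid X.carrier)) →
        Quotient (isIsomorphicSetoid (Fin k → X.carrier)) :=
      fun q => Quotient.mk _ fun i => (q i).out
    refine Finite.of_surjective f fun c => ?_
    induction c using Quotient.inductionOn with
    | h c =>
      refine ⟨fun i => Quotient.mk _ (c i), Quotient.sound ?_⟩
      exact ⟨Pi.isoMk fun i => (out_iso (c i)).some⟩
  finite_hom := fun x y => inferInstanceAs (Finite (∀ i, x i ⟶ y i))

end ParityGroupoid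

open ParityGroupoid

/-- A (right) action of a group `G` on a parity groupoid `X`, written `x ↦ x.g`: a morphism of
parity groupoids for each `g`, with coherent 2-cells `x ≅ x.1` and `(x.g).h ≅ x.(gh)`. A strict
action is the case where these 2-cells are identities. -/
structure PAction (G : Type) [Group G] (X : ParityGroupoid.{u}) where
  act : G → (X ⟶ X)
  one : 𝟙 X ⟶ act 1
  mul : ∀ {g h m : G}, g * h = m → (act g ≫ act h ⟶ act m)
  one_mul : ∀ (g : G) (x : X.carrier),
    (act g).func.map (one.nat.app x) ≫ (mul (_root_.one_mul g)).nat.app x = 𝟙 _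
  mul_one : ∀ (g : G) (x : X.carrier),
    one.nat.app ((act g).func.obj x) ≫ (mul (_root_.mul_one g)).nat.app x = 𝟙 _
  assoc : ∀ {g h l gh hl m : G} (e₁ : g * h = gh) (e₂ : gh * l = m) (e₃ : h * l = hl)
    (e₄ : g * hl = m) (x : X.carrier),
    (act l).func.map ((mul e₁).nat.app x) ≫ (mul e₂).nat.app x =
      (mul e₃).nat.app ((act g).func.obj x) ≫ (mul e₄).nat.app x

namespace PAction

variable {G : Type} [Group G] {X : ParityGroupoid.{u}} (a : PAction G X)

/-- The component `x ⟶ x.1` of the unit 2-cell. -/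
def oneApp (x : X.carrier) : x ⟶ (a.act 1).func.obj x := a.one.nat.app x

/-- The component `(x.g).h ⟶ x.(gh)` of the multiplication 2-cell. -/
def mulApp {g h m : G} (e : g * h = m) (x : X.carrier) :
    (a.act h).func.obj ((a.act g).func.obj x) ⟶ (a.act m).func.obj x := (a.mul e).nat.app x

theorem oneApp_naturality {x y : X.carrier} (f : x ⟶ y) :
    f ≫ a.oneApp y = a.oneApp x ≫ (a.act 1).func.map f :=
  a.one.nat.naturality f

theorem mulApp_naturality {g h m : G} (e : g * h = m) {x y : X.carrier} (f : x ⟶ y) :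
    (a.act h).func.map ((a.act g).func.map f) ≫ a.mulApp e y =
      a.mulApp e x ≫ (a.act m).func.map f :=
  (a.mul e).nat.naturality f

theorem oneApp_compat (x : X.carrier) :
    X.par.map (a.oneApp x) = (a.act 1).cell.app x :=
  (Category.id_comp _).symm.trans (a.one.compat x)

theorem mulApp_compat {g h m : G} (e : g * h = m) (x : X.carrier) :
    (a.act g).cell.app x ≫ (a.act h).cell.app ((a.act g).func.obj x) ≫
      X.par.map (a.mulApp e x) = (a.act m).cell.app x :=
  (Category.assoc _ _ _).symm.trans ((a.mul e).compat x)

theorem map_oneApp_mulApp {g m : G} (e : 1 * g = m) (e' : g = m) (x : X.carrier) :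
    (a.act g).func.map (a.oneApp x) ≫ a.mulApp e x = eqToHom (by rw [e']) := by
  subst e'
  exact a.one_mul g x

theorem oneApp_mulApp {g m : G} (e : g * 1 = m) (e' : g = m) (x : X.carrier) :
    a.oneApp ((a.act g).func.obj x) ≫ a.mulApp e x = eqToHom (by rw [e']) := by
  subst e'
  exact a.mul_one g x

theorem mulApp_assoc {g h l gh hl m : G} (e₁ : g * h = gh) (e₂ : gh * l = m) (e₃ : h * l = hl)
    (e₄ : g * hl = m) (x : X.carrier) :
    (a.act l).func.map (a.mulApp e₁ x) ≫ a.mulApp e₂ x =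
      a.mulApp e₃ ((a.act g).func.obj x) ≫ a.mulApp e₄ x :=
  a.assoc e₁ e₂ e₃ e₄ x

theorem mulApp_eqToHom {g h m m' : G} (e : g * h = m) (e' : m = m') (x : X.carrier) :
    a.mulApp e x ≫ eqToHom (by rw [e']) = a.mulApp (e.trans e') x := by
  subst e'
  simp

end PAction

/-- The signed permutation action of `Σ_k` on `X * ⋯ * X`: `x.σ = x ∘ σ`, the 2-cell over `P`
being constantly the sign of `σ`. -/
def signedAction (X : ParityGroupoid.{u}) (k : ℕ) :
    PAction (Equiv.Perm (Fin k)) (X.power k) where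
  act σ :=
    { func :=
        { obj := fun x i => x (σ i)
          map := fun γ i => γ (σ i) }
      cell :=
        { app := fun _ => (Equiv.Perm.sign σ : ℤˣ)
          naturality := fun x y f => by
            change (Equiv.Perm.sign σ) * (∏ i, X.parity (f i)) =
              (∏ i, X.parity (f (σ i))) * (Equiv.Perm.sign σ)
            rw [mul_comm, Equiv.prod_comp σ (fun i => X.parity (f i))] } }
  one := mkCell (fun x i => 𝟙 (x i))
    (fun f => by
      funext i
      change f i ≫ 𝟙 _ = 𝟙 _ ≫ f i
      simp)
    (fun x => by
      change (∏ i, X.parity (𝟙 (x i))) * 1 = Equiv.Perm.sign 1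
      simp [parity_id])
  mul {g h m} e := mkCell (fun x i => eqToHom (by subst e; rfl))
    (fun f => by
      subst e
      funext i
      change f (g (h i)) ≫ 𝟙 _ = 𝟙 _ ≫ f (g (h i))
      simp)
    (fun x => by
      subst e
      change (∏ i, X.parity (𝟙 (x (g (h i))))) * (Equiv.Perm.sign h * Equiv.Perm.sign g) =
        Equiv.Perm.sign (g * h)
      simp [parity_id, mul_comm])
  one_mul g x := by
    funext i
    change 𝟙 (x (g i)) ≫ 𝟙 (x (g i)) = 𝟙 (x (g i))
    simp
  mul_one g x := by
    funext i
    change 𝟙 (x (g i)) ≫ 𝟙 (x (g i)) = 𝟙 (x (g i))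
    simp
  assoc := by
    intro g h l gh hl m e₁ e₂ e₃ e₄ x
    subst e₁ e₂ e₃
    rfl

/-- Objects of the weak quotient of a group action. -/
@[ext]
structure QuotObj {G : Type} [Group G] {X : ParityGroupoid.{u}} (a : PAction G X) : Type u where
  pt : X.carrier

/-- Arrows `x ⟶ y` of the weak quotient: a group element `g` and an arrow `x ⟶ y.g` in `X`
(followed by the formal new arrow `y.g ⟶ y`). -/
structure QuotHom {G : Type} [Group G] {X : ParityGroupoid.{u}} (a : PAction G X)
    (x y : QuotObj a) : Type u where
  elt : G
  arr : x.pt ⟶ (a.act elt).func.obj y.pt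

section Quot

variable {G : Type} [Group G] {X : ParityGroupoid.{u}} (a : PAction G X)

theorem QuotHom.ext_of {a : PAction G X} {x y : QuotObj a} {f f' : QuotHom a x y}
    (e : f.elt = f'.elt)
    (h : f.arr ≫ eqToHom (by rw [e]) = f'.arr) : f = f' := by
  cases f; cases f'
  cases e
  simp at h
  subst h
  rfl

instance : CategoryStruct (QuotObj a) where
  Hom := QuotHom a
  id x := ⟨1, a.oneApp x.pt⟩
  comp {_ _ z} f f' := ⟨f'.elt * f.elt,
    f.arr ≫ (a.act f.elt).func.map f'.arr ≫ a.mulApp rfl z.pt⟩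

theorem quot_id_arr (x : QuotObj a) : QuotHom.arr (𝟙 x) = a.oneApp x.pt := rfl

theorem quot_comp_arr {x y z : QuotObj a} (f : x ⟶ y) (f' : y ⟶ z) :
    QuotHom.arr (f ≫ f') =
      f.arr ≫ (a.act f.elt).func.map f'.arr ≫ a.mulApp rfl z.pt := rfl

theorem quot_comp_elt {x y z : QuotObj a} (f : x ⟶ y) (f' : y ⟶ z) :
    QuotHom.elt (f ≫ f') = f'.elt * f.elt := rfl

instance quotCategory : Category (QuotObj a) where
  id_comp {x y} f := QuotHom.ext_of (_root_.mul_one _) (by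
    change (a.oneApp x.pt ≫ (a.act 1).func.map f.arr ≫ a.mulApp rfl y.pt) ≫ _ = f.arr
    simp only [Category.assoc]
    rw [← Category.assoc, ← a.oneApp_naturality]
    simp only [Category.assoc]
    rw [← Category.assoc (a.oneApp _),
      a.oneApp_mulApp _ (_root_.mul_one _).symm]
    simp)
  comp_id {x y} f := QuotHom.ext_of (_root_.one_mul _) (by
    change (f.arr ≫ (a.act f.elt).func.map (a.oneApp y.pt) ≫ a.mulApp rfl y.pt) ≫ _ = f.arr
    rw [a.map_oneApp_mulApp _ (_root_.one_mul _).symm]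
    simp)
  assoc {x y z w} f f' f'' := QuotHom.ext_of (_root_.mul_assoc _ _ _).symm (by
    change ((f.arr ≫ (a.act f.elt).func.map f'.arr ≫ a.mulApp rfl z.pt) ≫
      (a.act (f'.elt * f.elt)).func.map f''.arr ≫ a.mulApp rfl w.pt) ≫ _ =
      f.arr ≫ (a.act f.elt).func.map (f'.arr ≫ (a.act f'.elt).func.map f''.arr ≫
        a.mulApp rfl w.pt) ≫ a.mulApp rfl w.pt
    simp only [Category.assoc, Functor.map_comp]
    rw [a.mulApp_eqToHom _ (_root_.mul_assoc _ _ _).symm,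
      ← Category.assoc (a.mulApp _ _), ← a.mulApp_naturality,
      a.mulApp_assoc rfl _ rfl (_root_.mul_assoc _ _ _).symm]
    simp only [Category.assoc])

/-- The arrow of the weak quotient coming from an arrow of `X`. -/
def oldArrow {x y : X.carrier} (f : x ⟶ y) : (⟨x⟩ : QuotObj a) ⟶ ⟨y⟩ := ⟨1, f ≫ a.oneApp y⟩

/-- The new arrow `x.g ⟶ x` of the weak quotient. -/
def newArrow (g : G) (x : X.carrier) : (⟨(a.act g).func.obj x⟩ : QuotObj a) ⟶ ⟨x⟩ := ⟨g, 𝟙 _⟩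

theorem QuotHom.mk_eq {a : PAction G X} {x y : QuotObj a} {g g' : G} (e : g = g')
    {f : x.pt ⟶ (a.act g).func.obj y.pt} {f' : x.pt ⟶ (a.act g').func.obj y.pt}
    (h : f ≫ eqToHom (by rw [e]) = f') : (⟨g, f⟩ : QuotHom a x y) = ⟨g', f'⟩ :=
  QuotHom.ext_of e h

/-- The inverse of an arrow of the weak quotient. -/
noncomputable def quotInv {x y : QuotObj a} (f : x ⟶ y) : y ⟶ x :=
  ⟨f.elt⁻¹, a.oneApp y.pt ≫ inv (a.mulApp (mul_inv_cancel f.elt) y.pt) ≫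
    (a.act f.elt⁻¹).func.map (inv f.arr)⟩

theorem quotInv_comp {x y : QuotObj a} (f : x ⟶ y) : quotInv a f ≫ f = 𝟙 y :=
  QuotHom.mk_eq (a := a)
    (f := (a.oneApp y.pt ≫ inv (a.mulApp (mul_inv_cancel f.elt) y.pt) ≫
      (a.act f.elt⁻¹).func.map (inv f.arr)) ≫ (a.act f.elt⁻¹).func.map f.arr ≫
        a.mulApp rfl y.pt)
    (f' := a.oneApp y.pt) (mul_inv_cancel f.elt) (by
    simp only [Category.assoc]
    rw [← Category.assoc ((a.act f.elt⁻¹).func.map (inv f.arr)), ← Functor.map_comp,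
      a.mulApp_eqToHom rfl (mul_inv_cancel f.elt)]
    simp)

noncomputable instance quotGroupoid : Groupoid (QuotObj a) where
  inv f := quotInv a f
  inv_comp f := quotInv_comp a f
  comp_inv {x y} f := by
    calc f ≫ quotInv a f
        = (quotInv a (quotInv a f) ≫ quotInv a f) ≫ f ≫ quotInv a f := by
          rw [quotInv_comp, Category.id_comp]
      _ = quotInv a (quotInv a f) ≫ (quotInv a f ≫ f) ≫ quotInv a f := by
          simp only [Category.assoc]
      _ = 𝟙 x := by rw [quotInv_comp, Category.id_comp, quotInv_comp]

/-- The weak quotient `X/G`. Old arrows keep their parity, and the parity of a new arrow is given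
by the 2-cell over `P` of the action. -/
noncomputable def weakQuotient [Finite G] : ParityGroupoid.{u} where
  carrier := QuotObj a
  par :=
    { obj := fun x => X.par.obj x.pt
      map := fun {_ y} f => X.par.map f.arr ≫ inv ((a.act f.elt).cell.app y.pt)
      map_id := fun x => by
        change X.par.map (a.oneApp x.pt) ≫ inv ((a.act 1).cell.app x.pt) = _
        rw [a.oneApp_compat]
        exact IsIso.hom_inv_id _
      map_comp := fun {x y z} f f' => by
        change X.par.map (f.arr ≫ (a.act f.elt).func.map f'.arr ≫ a.mulApp rfl z.pt) ≫
          inv ((a.act (f'.elt * f.elt)).cell.app z.pt) =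
          (X.par.map f.arr ≫ inv ((a.act f.elt).cell.app y.pt)) ≫
            X.par.map f'.arr ≫ inv ((a.act f'.elt).cell.app z.pt)
        have h1 := cell_naturality (a.act f.elt) f'.arr
        have h2 := a.mulApp_compat (rfl : f'.elt * f.elt = _) z.pt
        rw [← h2]
        simp only [Functor.map_comp, Category.assoc, IsIso.inv_comp]
        congr 1
        have h3 : X.par.map ((a.act f.elt).func.map f'.arr) ≫
            inv ((a.act f.elt).cell.app ((a.act f'.elt).func.obj z.pt)) =
            inv ((a.act f.elt).cell.app y.pt) ≫ X.par.map f'.arr := by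
          rw [IsIso.comp_inv_eq, Category.assoc, h1, IsIso.inv_hom_id_assoc]
        rw [IsIso.hom_inv_id_assoc, ← Category.assoc, h3, Category.assoc] }
  finite_components := by
    refine Finite.of_surjective
      (Quotient.map' (s₁ := isIsomorphicSetoid X.carrier) (fun x => (⟨x⟩ : QuotObj a))
        fun x y h => ?_) ?_
    · exact ⟨Groupoid.isoEquivHom _ _ |>.symm (oldArrow a h.some.hom)⟩
    · intro c
      induction c using Quotient.inductionOn with
      | h c => exact ⟨Quotient.mk _ c.pt, rfl⟩
  finite_hom := fun x y => by
    refine Finite.of_injective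
      (β := Σ g : G, (x.pt ⟶ (a.act g).func.obj y.pt)) (fun f : QuotHom a x y => ⟨f.elt, f.arr⟩) ?_
    rintro ⟨g, f⟩ ⟨g', f'⟩ h
    cases h
    rfl

end Quot

/-- The exterior power `Λ^k X = X^k/Σ_k`: the weak quotient of the signed permutation action. -/
noncomputable def exteriorPower (X : ParityGroupoid.{u}) (k : ℕ) : ParityGroupoid.{u} :=
  weakQuotient (signedAction X k)

section Quot

variable {G : Type} [Group G] [Finite G] {X : ParityGroupoid.{u}} (a : PAction G X)

/-- The quotient map `X ⟶ X/G`. -/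
noncomputable def quotientMap : X ⟶ weakQuotient a where
  func :=
    { obj := fun x => (⟨x⟩ : QuotObj a)
      map := fun f => oldArrow a f
      map_id := fun x => QuotHom.mk_eq (a := a) (f := 𝟙 x ≫ a.oneApp x) (f' := a.oneApp x) rfl
        (by simp)
      map_comp := fun {x y z} f f' => QuotHom.mk_eq (a := a) (f := (f ≫ f') ≫ a.oneApp z)
        (f' := (f ≫ a.oneApp y) ≫ (a.act 1).func.map (f' ≫ a.oneApp z) ≫ a.mulApp rfl z)
        (_root_.mul_one 1).symm (by
          rw [Functor.map_comp]
          simp only [Category.assoc]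
          rw [a.map_oneApp_mulApp rfl (_root_.mul_one 1).symm,
            ← Category.assoc (a.oneApp y), ← a.oneApp_naturality]
          simp) }
  cell :=
    { app := fun x => 𝟙 (X.par.obj x)
      naturality := fun x y f => by
        change X.par.map f ≫ 𝟙 _ =
          𝟙 _ ≫ X.par.map (f ≫ a.oneApp y) ≫ inv ((a.act 1).cell.app y)
        rw [Functor.map_comp, a.oneApp_compat, Category.assoc, IsIso.hom_inv_id]
        exact (Category.id_comp _).symm }

end Quot

/-- Compatibility of a morphism `F : X ⟶ Y` with two actions: coherent 2-cells
`F (x.g) ≅ (F x).g`. -/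
structure Equivariance {G : Type} [Group G] {X Y : ParityGroupoid.{u}} (a : PAction G X)
    (b : PAction G Y) (F : X ⟶ Y) where
  cell : ∀ g, a.act g ≫ F ⟶ F ≫ b.act g
  one : ∀ x, F.func.map (a.oneApp x) ≫ (cell 1).nat.app x = b.oneApp (F.func.obj x)
  mul : ∀ {g h m : G} (e : g * h = m) (x),
    F.func.map (a.mulApp e x) ≫ (cell m).nat.app x =
      (cell h).nat.app ((a.act g).func.obj x) ≫
        (b.act h).func.map ((cell g).nat.app x) ≫ b.mulApp e (F.func.obj x)

/-- A cocone under an action with vertex `F : X ⟶ Y`: coherent 2-cells `F (x.g) ≅ F x`. -/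
structure Invariance {G : Type} [Group G] {X Y : ParityGroupoid.{u}} (a : PAction G X)
    (F : X ⟶ Y) where
  cell : ∀ g, a.act g ≫ F ⟶ F
  one : ∀ x, F.func.map (a.oneApp x) ≫ (cell 1).nat.app x = 𝟙 (F.func.obj x)
  mul : ∀ {g h m : G} (e : g * h = m) (x),
    F.func.map (a.mulApp e x) ≫ (cell m).nat.app x =
      (cell h).nat.app ((a.act g).func.obj x) ≫ (cell g).nat.app x

namespace Equivariance

variable {G : Type} [Group G] {X Y : ParityGroupoid.{u}} {a : PAction G X} {b : PAction G Y}
  {F : X ⟶ Y} (s : Equivariance a b F)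

/-- The component `F (x.g) ⟶ (F x).g`. -/
def app (g : G) (x : X.carrier) :
    F.func.obj ((a.act g).func.obj x) ⟶ (b.act g).func.obj (F.func.obj x) :=
  (s.cell g).nat.app x

theorem naturality (g : G) {x y : X.carrier} (f : x ⟶ y) :
    F.func.map ((a.act g).func.map f) ≫ s.app g y =
      s.app g x ≫ (b.act g).func.map (F.func.map f) :=
  (s.cell g).nat.naturality f

theorem compat (g : G) (x : X.carrier) :
    (a.act g).cell.app x ≫ F.cell.app ((a.act g).func.obj x) ≫ Y.par.map (s.app g x) =
      F.cell.app x ≫ (b.act g).cell.app (F.func.obj x) :=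
  (Category.assoc _ _ _).symm.trans ((s.cell g).compat x)

theorem one_app (x : X.carrier) :
    F.func.map (a.oneApp x) ≫ s.app 1 x = b.oneApp (F.func.obj x) := s.one x

theorem mul_app {g h m : G} (e : g * h = m) (x : X.carrier) :
    F.func.map (a.mulApp e x) ≫ s.app m x = s.app h ((a.act g).func.obj x) ≫
      (b.act h).func.map (s.app g x) ≫ b.mulApp e (F.func.obj x) := s.mul e x

end Equivariance

namespace Invariance

variable {G : Type} [Group G] {X Y : ParityGroupoid.{u}} {a : PAction G X}
  {F : X ⟶ Y} (t : Invariance a F)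

/-- The component `F (x.g) ⟶ F x`. -/
def app (g : G) (x : X.carrier) : F.func.obj ((a.act g).func.obj x) ⟶ F.func.obj x :=
  (t.cell g).nat.app x

theorem naturality (g : G) {x y : X.carrier} (f : x ⟶ y) :
    F.func.map ((a.act g).func.map f) ≫ t.app g y = t.app g x ≫ F.func.map f :=
  (t.cell g).nat.naturality f

theorem compat (g : G) (x : X.carrier) :
    (a.act g).cell.app x ≫ F.cell.app ((a.act g).func.obj x) ≫ Y.par.map (t.app g x) =
      F.cell.app x :=
  (Category.assoc _ _ _).symm.trans ((t.cell g).compat x)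

theorem one_app (x : X.carrier) : F.func.map (a.oneApp x) ≫ t.app 1 x = 𝟙 _ := t.one x

theorem mul_app {g h m : G} (e : g * h = m) (x : X.carrier) :
    F.func.map (a.mulApp e x) ≫ t.app m x =
      t.app h ((a.act g).func.obj x) ≫ t.app g x := t.mul e x

end Invariance

section Pullback

variable {X Y S : ParityGroupoid.{u}} (F : X ⟶ S) (H : Y ⟶ S)

noncomputable instance commaGroupoid : Groupoid (Comma F.func H.func) where
  inv f := { left := inv f.left, right := inv f.right, w := by simp }

/-- The homotopy pullback of `F : X ⟶ S` and `H : Y ⟶ S`: the objects are triples of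
`x : X`, `y : Y` and an arrow `F x ⟶ H y` in `S`. -/
noncomputable def pullback : ParityGroupoid.{u} where
  carrier := Comma F.func H.func
  par := Comma.fst _ _ ⋙ X.par
  finite_components := by
    let Q := Σ p : Quotient (isIsomorphicSetoid X.carrier) ×
      Quotient (isIsomorphicSetoid Y.carrier), (F.func.obj p.1.out ⟶ H.func.obj p.2.out)
    refine Finite.of_surjective (α := Q) (fun q => Quotient.mk _ ⟨q.1.1.out, q.1.2.out, q.2⟩) ?_
    intro c
    induction c using Quotient.inductionOn with
    | h c =>
      obtain ⟨e⟩ := out_iso c.left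
      obtain ⟨e'⟩ := out_iso c.right
      exact ⟨⟨(Quotient.mk _ c.left, Quotient.mk _ c.right),
        F.func.map e.hom ≫ c.hom ≫ H.func.map e'.inv⟩,
        Quotient.sound ⟨Comma.isoMk e e' (by simp)⟩⟩
  finite_hom := fun c d => by
    refine Finite.of_injective (β := (c.left ⟶ d.left) × (c.right ⟶ d.right))
      (fun f : CommaMorphism c d => (f.left, f.right)) ?_
    rintro f f' h
    exact CommaMorphism.ext (congrArg Prod.fst h) (congrArg Prod.snd h)

/-- The first projection of the homotopy pullback. -/
noncomputable def pullbackFst : pullback F H ⟶ X where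
  func := Comma.fst _ _
  cell :=
    { app := fun c => 𝟙 (X.par.obj c.left)
      naturality := fun _ _ f =>
        (Category.comp_id (X.par.map f.left)).trans (Category.id_comp (X.par.map f.left)).symm }

/-- The second projection of the homotopy pullback. Its 2-cell over `P` is the one for which
the square of projections is filled by the 2-cell `F x ≅ H y` over `P`. -/
noncomputable def pullbackSnd : pullback F H ⟶ Y where
  func := Comma.snd _ _
  cell :=
    { app := fun c => F.cell.app c.left ≫ S.par.map c.hom ≫ inv (H.cell.app c.right)
      naturality := fun c d f => by
        change X.par.map f.left ≫ _ = _ ≫ Y.par.map f.right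
        have h1 := cell_naturality F f.left
        have h2 := cell_naturality H f.right
        have h3 := congrArg S.par.map f.w
        rw [Functor.map_comp, Functor.map_comp] at h3
        have h4 : S.par.map (H.func.map f.right) ≫ inv (H.cell.app d.right) =
            inv (H.cell.app c.right) ≫ Y.par.map f.right := by
          rw [IsIso.comp_inv_eq, Category.assoc, h2, IsIso.inv_hom_id_assoc]
        rw [← Category.assoc, h1]
        simp only [Category.assoc]
        rw [← h4, ← Category.assoc (S.par.map (F.func.map f.left)), h3, Category.assoc] }

end Pullback

/-- A `P`-span `S ⟵ M ⟶ T` of parity groupoids; these are the linear functors from the slice over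
`S` to the slice over `T`. -/
structure PSpan (S T : ParityGroupoid.{u}) : Type (u + 1) where
  apex : ParityGroupoid.{u}
  left : apex ⟶ S
  right : apex ⟶ T

namespace PSpan

variable {S T : ParityGroupoid.{u}}

/-- Morphisms of `P`-spans. -/
structure Hom (M N : PSpan S T) : Type u where
  map : M.apex ⟶ N.apex
  leftCell : map ≫ N.left ⟶ M.left
  rightCell : map ≫ N.right ⟶ M.right

namespace Hom

variable {M N : PSpan S T}

/-- An equivalence of `P`-spans is a morphism whose underlying functor is an equivalence. -/
def IsEquivalence (v : Hom M N) : Prop := v.map.func.IsEquivalence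

/-- The component of the left 2-cell. -/
def leftApp (v : Hom M N) (x : M.apex.carrier) :
    N.left.func.obj (v.map.func.obj x) ⟶ M.left.func.obj x := v.leftCell.nat.app x

/-- The component of the right 2-cell. -/
def rightApp (v : Hom M N) (x : M.apex.carrier) :
    N.right.func.obj (v.map.func.obj x) ⟶ M.right.func.obj x := v.rightCell.nat.app x

theorem leftApp_naturality (v : Hom M N) {x y : M.apex.carrier} (f : x ⟶ y) :
    N.left.func.map (v.map.func.map f) ≫ v.leftApp y = v.leftApp x ≫ M.left.func.map f :=
  v.leftCell.nat.naturality f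

theorem rightApp_naturality (v : Hom M N) {x y : M.apex.carrier} (f : x ⟶ y) :
    N.right.func.map (v.map.func.map f) ≫ v.rightApp y = v.rightApp x ≫ M.right.func.map f :=
  v.rightCell.nat.naturality f

theorem leftApp_compat (v : Hom M N) (x : M.apex.carrier) :
    v.map.cell.app x ≫ N.left.cell.app (v.map.func.obj x) ≫ S.par.map (v.leftApp x) =
      M.left.cell.app x :=
  (Category.assoc _ _ _).symm.trans (v.leftCell.compat x)

theorem rightApp_compat (v : Hom M N) (x : M.apex.carrier) :
    v.map.cell.app x ≫ N.right.cell.app (v.map.func.obj x) ≫ T.par.map (v.rightApp x) =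
      M.right.cell.app x :=
  (Category.assoc _ _ _).symm.trans (v.rightCell.compat x)

end Hom

/-- 2-cells between parallel morphisms of `P`-spans. -/
structure Hom₂ {M N : PSpan S T} (v w : Hom M N) : Type u where
  cell : v.map ⟶ w.map
  left : ∀ x, N.left.func.map (cell.nat.app x) ≫ w.leftApp x = v.leftApp x
  right : ∀ x, N.right.func.map (cell.nat.app x) ≫ w.rightApp x = v.rightApp x

end PSpan

/-- A `P`-span `S ⟵ A ⟶ T` together with compatible 2-cells expressing its invariance under an
action of `G` on `S`: an action of `G` on `A`, equivariance of the left leg, and the structure of a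
cocone under the action on the right leg (since the `g` act by equivalences, the equivariance
squares are automatically homotopy pullbacks). -/
structure InvariantSpan {G : Type} [Group G] {S : ParityGroupoid.{u}} (a : PAction G S)
    (T : ParityGroupoid.{u}) extends PSpan S T where
  action : PAction G apex
  equivariance : Equivariance action a left
  invariance : Invariance action right

/-- Alternating linear functors from the `k`-fold tensor power of the slice over `X` to the slice
over `W`: `P`-spans `X^k ⟵ A ⟶ W` with compatible 2-cells for the signed action of `Σ_k`. -/
abbrev AlternatingSpan (X : ParityGroupoid.{u}) (k : ℕ) (W : ParityGroupoid.{u}) :=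
  InvariantSpan (signedAction X k) W

namespace InvariantSpan

variable {G : Type} [Group G] {S : ParityGroupoid.{u}} {a : PAction G S}
  {T W : ParityGroupoid.{u}}

/-- Morphisms of invariant spans: morphisms of `P`-spans with an equivariance structure compatible
with those of the legs. -/
structure Hom (A B : InvariantSpan a T) extends PSpan.Hom A.toPSpan B.toPSpan where
  equivariance : Equivariance A.action B.action map
  left_comp : ∀ (g : G) (x : A.apex.carrier),
    B.left.func.map (equivariance.app g x) ≫ B.equivariance.app g (map.func.obj x) ≫
        (a.act g).func.map (toHom.leftApp x) =
      toHom.leftApp ((A.action.act g).func.obj x) ≫ A.equivariance.app g x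
  right_comp : ∀ (g : G) (x : A.apex.carrier),
    B.right.func.map (equivariance.app g x) ≫ B.invariance.app g (map.func.obj x) ≫
        toHom.rightApp x =
      toHom.rightApp ((A.action.act g).func.obj x) ≫ A.invariance.app g x

/-- 2-cells between parallel morphisms of invariant spans. -/
structure Hom₂ {A B : InvariantSpan a T} (v w : Hom A B) extends
    PSpan.Hom₂ v.toHom w.toHom where
  comm : ∀ (g : G) (x : A.apex.carrier),
    cell.nat.app ((A.action.act g).func.obj x) ≫ w.equivariance.app g x =
      v.equivariance.app g x ≫ (B.action.act g).func.map (cell.nat.app x)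

/-- Composition of morphisms of invariant spans. -/
def Hom.comp {A B C : InvariantSpan a T} (v : Hom A B) (w : Hom B C) : Hom A C where
  map := v.map ≫ w.map
  leftCell := mkCell (F := (v.map ≫ w.map) ≫ C.left) (G := A.left)
    (fun x => w.leftApp (v.map.func.obj x) ≫ v.leftApp x)
    (fun {x y} f => by
      change C.left.func.map (w.map.func.map (v.map.func.map f)) ≫ w.leftApp _ ≫ v.leftApp y =
        (w.leftApp _ ≫ v.leftApp x) ≫ A.left.func.map f
      rw [reassoc_of% (w.leftApp_naturality (v.map.func.map f)), v.leftApp_naturality,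
        Category.assoc])
    (fun x => by
      change ((v.map.cell.app x ≫ w.map.cell.app _) ≫ C.left.cell.app _) ≫
        S.par.map (w.leftApp _ ≫ v.leftApp x) = A.left.cell.app x
      rw [Functor.map_comp, Category.assoc, Category.assoc,
        reassoc_of% (w.leftApp_compat (v.map.func.obj x)), v.leftApp_compat])
  rightCell := mkCell (F := (v.map ≫ w.map) ≫ C.right) (G := A.right)
    (fun x => w.rightApp (v.map.func.obj x) ≫ v.rightApp x)
    (fun {x y} f => by
      change C.right.func.map (w.map.func.map (v.map.func.map f)) ≫ w.rightApp _ ≫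
        v.rightApp y = (w.rightApp _ ≫ v.rightApp x) ≫ A.right.func.map f
      rw [reassoc_of% (w.rightApp_naturality (v.map.func.map f)), v.rightApp_naturality,
        Category.assoc])
    (fun x => by
      change ((v.map.cell.app x ≫ w.map.cell.app _) ≫ C.right.cell.app _) ≫
        T.par.map (w.rightApp _ ≫ v.rightApp x) = A.right.cell.app x
      rw [Functor.map_comp, Category.assoc, Category.assoc,
        reassoc_of% (w.rightApp_compat (v.map.func.obj x)), v.rightApp_compat])
  equivariance :=
    { cell := fun g => mkCell (F := A.action.act g ≫ v.map ≫ w.map)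
        (G := (v.map ≫ w.map) ≫ C.action.act g)
        (fun x => w.map.func.map (v.equivariance.app g x) ≫
          w.equivariance.app g (v.map.func.obj x))
        (fun {x y} f => by
          change w.map.func.map (v.map.func.map ((A.action.act g).func.map f)) ≫
            w.map.func.map (v.equivariance.app g y) ≫ w.equivariance.app g _ =
            (w.map.func.map (v.equivariance.app g x) ≫ w.equivariance.app g _) ≫
              (C.action.act g).func.map (w.map.func.map (v.map.func.map f))
          rw [← Functor.map_comp_assoc, v.equivariance.naturality, Functor.map_comp_assoc,
            w.equivariance.naturality, Category.assoc])
        (fun x => by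
          change ((A.action.act g).cell.app x ≫ v.map.cell.app _ ≫ w.map.cell.app _) ≫
            C.apex.par.map (w.map.func.map (v.equivariance.app g x) ≫
              w.equivariance.app g _) =
            (v.map.cell.app x ≫ w.map.cell.app _) ≫ (C.action.act g).cell.app _
          have h := cell_naturality w.map (v.equivariance.app g x)
          rw [Functor.map_comp, Category.assoc, Category.assoc, Category.assoc,
            ← reassoc_of% h, reassoc_of% (v.equivariance.compat g x),
            w.equivariance.compat])
      one := fun x => by
        change w.map.func.map (v.map.func.map (A.action.oneApp x)) ≫
          w.map.func.map (v.equivariance.app 1 x) ≫ w.equivariance.app 1 _ = C.action.oneApp _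
        rw [← Functor.map_comp_assoc, v.equivariance.one_app, w.equivariance.one_app]
      mul := fun {g h m} e x => by
        change w.map.func.map (v.map.func.map (A.action.mulApp e x)) ≫
          w.map.func.map (v.equivariance.app m x) ≫ w.equivariance.app m _ =
          (w.map.func.map (v.equivariance.app h _) ≫ w.equivariance.app h _) ≫
            (C.action.act h).func.map (w.map.func.map (v.equivariance.app g x) ≫
              w.equivariance.app g _) ≫ C.action.mulApp e _
        rw [← Functor.map_comp_assoc, v.equivariance.mul_app, Functor.map_comp_assoc,
          Functor.map_comp_assoc, w.equivariance.mul_app, Functor.map_comp,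
          reassoc_of% (w.equivariance.naturality h (v.equivariance.app g x))]
        simp only [Category.assoc] }
  left_comp := fun g x => by
    change C.left.func.map (w.map.func.map (v.equivariance.app g x) ≫
        w.equivariance.app g _) ≫ C.equivariance.app g _ ≫
          (a.act g).func.map (w.leftApp _ ≫ v.leftApp x) =
      (w.leftApp _ ≫ v.leftApp _) ≫ A.equivariance.app g x
    have h1 := w.left_comp g (v.map.func.obj x)
    rw [Functor.map_comp, Functor.map_comp, Category.assoc, reassoc_of% h1,
      reassoc_of% (w.leftApp_naturality (v.equivariance.app g x)), v.left_comp, Category.assoc]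
  right_comp := fun g x => by
    change C.right.func.map (w.map.func.map (v.equivariance.app g x) ≫
        w.equivariance.app g _) ≫ C.invariance.app g _ ≫ w.rightApp _ ≫ v.rightApp x =
      (w.rightApp _ ≫ v.rightApp _) ≫ A.invariance.app g x
    have h1 := w.right_comp g (v.map.func.obj x)
    rw [Functor.map_comp, Category.assoc, reassoc_of% h1,
      reassoc_of% (w.rightApp_naturality (v.equivariance.app g x)), v.right_comp, Category.assoc]

/-- The action of `g` on the homotopy pullback `A ×_T B`: `(x, y, γ).g = (x.g, y, γ ∘ α_g)`. -/
noncomputable def compAct (A : InvariantSpan a T) (B : PSpan T W) (g : G) :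
    pullback A.right B.left ⟶ pullback A.right B.left where
  func :=
    { obj := fun c => ⟨(A.action.act g).func.obj c.left, c.right,
        A.invariance.app g c.left ≫ c.hom⟩
      map := fun {c d} f => ⟨(A.action.act g).func.map f.left, f.right, by
        rw [reassoc_of% (A.invariance.naturality g f.left), f.w, Category.assoc]⟩
      map_id := fun c => CommaMorphism.ext ((A.action.act g).func.map_id c.left) rfl
      map_comp := fun f f' =>
        CommaMorphism.ext ((A.action.act g).func.map_comp f.left f'.left) rfl }
  cell :=
    { app := fun c => (A.action.act g).cell.app c.left
      naturality := fun c d f => (A.action.act g).cell.naturality f.left }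

/-- The action of `G` on the homotopy pullback `A ×_T B`. -/
noncomputable def compAction (A : InvariantSpan a T) (B : PSpan T W) :
    PAction G (pullback A.right B.left) where
  act := compAct A B
  one := mkCell (G := compAct A B 1) (fun c => ⟨A.action.oneApp c.left, 𝟙 c.right, by
      change A.right.func.map (A.action.oneApp c.left) ≫ A.invariance.app 1 c.left ≫ c.hom = _
      rw [reassoc_of% (A.invariance.one_app c.left)]
      change c.hom = c.hom ≫ B.left.func.map (𝟙 c.right)
      rw [CategoryTheory.Functor.map_id, Category.comp_id]⟩)
    (fun {c d} f => CommaMorphism.ext (A.action.oneApp_naturality f.left)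
      ((Category.comp_id f.right).trans (Category.id_comp f.right).symm))
    (fun c => (Category.id_comp _).trans (A.action.oneApp_compat c.left))
  mul {g h m} e := mkCell (F := compAct A B g ≫ compAct A B h) (G := compAct A B m)
    (fun c => ⟨A.action.mulApp e c.left, 𝟙 c.right, by
      change A.right.func.map (A.action.mulApp e c.left) ≫ A.invariance.app m c.left ≫ c.hom =
        (A.invariance.app h _ ≫ A.invariance.app g c.left ≫ c.hom) ≫ B.left.func.map (𝟙 c.right)
      rw [reassoc_of% (A.invariance.mul_app e c.left), CategoryTheory.Functor.map_id, Category.comp_id]⟩)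
    (fun {c d} f => CommaMorphism.ext (A.action.mulApp_naturality e f.left)
      ((Category.comp_id f.right).trans (Category.id_comp f.right).symm))
    (fun c => (Category.assoc _ _ _).trans (A.action.mulApp_compat e c.left))
  one_mul g c := CommaMorphism.ext (A.action.one_mul g c.left) (Category.comp_id (𝟙 c.right))
  mul_one g c := CommaMorphism.ext (A.action.mul_one g c.left) (Category.comp_id (𝟙 c.right))
  assoc e₁ e₂ e₃ e₄ c := CommaMorphism.ext (A.action.assoc e₁ e₂ e₃ e₄ c.left) rfl

/-- The composite of an invariant span `S ⟵ A ⟶ T` with a `P`-span `T ⟵ B ⟶ W`: the composite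
`P`-span has the homotopy pullback `A ×_T B` as apex, on which `G` acts through `A`. -/
noncomputable def comp (A : InvariantSpan a T) (B : PSpan T W) : InvariantSpan a W where
  apex := pullback A.right B.left
  left := pullbackFst A.right B.left ≫ A.left
  right := pullbackSnd A.right B.left ≫ B.right
  action := compAction A B
  equivariance :=
    { cell := fun g => mkCell (fun c => A.equivariance.app g c.left)
        (fun f => A.equivariance.naturality g f.left)
        (fun c => by
          change ((A.action.act g).cell.app c.left ≫ 𝟙 _ ≫ A.left.cell.app _) ≫
            S.par.map (A.equivariance.app g c.left) =
            (𝟙 _ ≫ A.left.cell.app c.left) ≫ (a.act g).cell.app _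
          rw [Category.id_comp, Category.id_comp, Category.assoc, A.equivariance.compat])
      one := fun c => A.equivariance.one_app c.left
      mul := fun e c => A.equivariance.mul_app e c.left }
  invariance :=
    { cell := fun g => mkCell (fun c => 𝟙 (B.right.func.obj c.right))
        (fun f => (Category.comp_id (B.right.func.map f.right)).trans
          (Category.id_comp (B.right.func.map f.right)).symm)
        (fun c => by
          change ((A.action.act g).cell.app c.left ≫ (A.right.cell.app _ ≫
            T.par.map (A.invariance.app g c.left ≫ c.hom) ≫ inv (B.left.cell.app c.right)) ≫
              B.right.cell.app c.right) ≫ W.par.map (𝟙 _) =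
            (A.right.cell.app c.left ≫ T.par.map c.hom ≫ inv (B.left.cell.app c.right)) ≫
              B.right.cell.app c.right
          rw [CategoryTheory.Functor.map_id, Functor.map_comp]
          refine (Category.comp_id _).trans ?_
          simp only [Category.assoc]
          rw [reassoc_of% (A.invariance.compat g c.left)])
      one := fun c => by
        change B.right.func.map (𝟙 c.right) ≫ 𝟙 (B.right.func.obj c.right) = 𝟙 _
        rw [CategoryTheory.Functor.map_id, Category.comp_id]
      mul := fun e c => by
        change B.right.func.map (𝟙 c.right) ≫ 𝟙 (B.right.func.obj c.right) = 𝟙 _ ≫ 𝟙 _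
        rw [CategoryTheory.Functor.map_id] }

/-- Functoriality of `B ↦ A.comp B` on morphisms of `P`-spans. -/
noncomputable def compMap (A : InvariantSpan a T) {B B' : PSpan T W} (v : PSpan.Hom B B') :
    Hom (A.comp B) (A.comp B') where
  map :=
    { func :=
        { obj := fun c => ⟨c.left, v.map.func.obj c.right, c.hom ≫ inv (v.leftApp c.right)⟩
          map := fun {c d} f => ⟨f.left, v.map.func.map f.right, by
            change A.right.func.map f.left ≫ d.hom ≫ inv (v.leftApp d.right) =
              (c.hom ≫ inv (v.leftApp c.right)) ≫ B'.left.func.map (v.map.func.map f.right)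
            have h := v.leftApp_naturality f.right
            rw [reassoc_of% f.w, Category.assoc]
            congr 1
            rw [IsIso.comp_inv_eq, Category.assoc, h, IsIso.inv_hom_id_assoc]⟩
          map_id := fun c => CommaMorphism.ext rfl (v.map.func.map_id c.right)
          map_comp := fun f f' => CommaMorphism.ext rfl (v.map.func.map_comp f.right f'.right) }
      cell :=
        { app := fun c => 𝟙 (A.apex.par.obj c.left)
          naturality := fun c d f => (Category.comp_id (A.apex.par.map f.left)).trans
            (Category.id_comp (A.apex.par.map f.left)).symm } }
  leftCell := mkCell (fun c => 𝟙 (A.left.func.obj c.left))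
    (fun f => (Category.comp_id (A.left.func.map f.left)).trans
      (Category.id_comp (A.left.func.map f.left)).symm)
    (fun c => by
      change (𝟙 _ ≫ 𝟙 _ ≫ A.left.cell.app c.left) ≫ S.par.map (𝟙 _) =
        𝟙 _ ≫ A.left.cell.app c.left
      rw [CategoryTheory.Functor.map_id]
      exact (Category.comp_id _).trans (Category.id_comp _))
  rightCell := mkCell (fun c => v.rightApp c.right)
    (fun f => v.rightApp_naturality f.right)
    (fun c => by
      change (𝟙 _ ≫ (A.right.cell.app c.left ≫ T.par.map (c.hom ≫ inv (v.leftApp c.right)) ≫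
        inv (B'.left.cell.app (v.map.func.obj c.right))) ≫
          B'.right.cell.app (v.map.func.obj c.right)) ≫ W.par.map (v.rightApp c.right) =
        (A.right.cell.app c.left ≫ T.par.map c.hom ≫ inv (B.left.cell.app c.right)) ≫
          B.right.cell.app c.right
      rw [← v.leftApp_compat c.right, ← v.rightApp_compat c.right]
      simp)
  equivariance :=
    { cell := fun g => mkCell
        (fun c => ⟨𝟙 ((A.action.act g).func.obj c.left), 𝟙 (v.map.func.obj c.right), by
          change A.right.func.map (𝟙 _) ≫ A.invariance.app g c.left ≫ c.hom ≫
            inv (v.leftApp c.right) = ((A.invariance.app g c.left ≫ c.hom) ≫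
            inv (v.leftApp c.right)) ≫ B'.left.func.map (𝟙 _)
          simp⟩)
        (fun f => CommaMorphism.ext
          ((Category.comp_id _).trans (Category.id_comp ((A.action.act g).func.map f.left)).symm)
          ((Category.comp_id _).trans (Category.id_comp (v.map.func.map f.right)).symm))
        (fun c => by
          change ((A.action.act g).cell.app c.left ≫ 𝟙 _) ≫ A.apex.par.map (𝟙 _) =
            𝟙 _ ≫ (A.action.act g).cell.app c.left
          rw [CategoryTheory.Functor.map_id, Category.comp_id]
          exact (Category.comp_id _).trans (Category.id_comp _).symm)
      one := fun c => CommaMorphism.ext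
        (Category.comp_id (A.action.oneApp c.left))
        ((Category.comp_id _).trans (v.map.func.map_id c.right))
      mul := fun {g h m} e c => CommaMorphism.ext
        (by
          change A.action.mulApp e c.left ≫ 𝟙 _ =
            𝟙 _ ≫ (A.action.act h).func.map (𝟙 _) ≫ A.action.mulApp e c.left
          simp)
        (by
          change v.map.func.map (𝟙 c.right) ≫ 𝟙 _ = 𝟙 _ ≫ 𝟙 _ ≫ 𝟙 _
          simp) }
  left_comp := fun g c => by
    change A.left.func.map (𝟙 _) ≫ A.equivariance.app g c.left ≫ (a.act g).func.map (𝟙 _) =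
      𝟙 _ ≫ A.equivariance.app g c.left
    simp
  right_comp := fun g c => by
    change B'.right.func.map (𝟙 _) ≫ 𝟙 _ ≫ v.rightApp c.right = v.rightApp c.right ≫ 𝟙 _
    simp

/-- Functoriality of `B ↦ A.comp B` on 2-cells. -/
noncomputable def compMap₂ (A : InvariantSpan a T) {B B' : PSpan T W} {v w : PSpan.Hom B B'}
    (η : PSpan.Hom₂ v w) : Hom₂ (A.compMap v) (A.compMap w) where
  cell := mkCell (F := (A.compMap v).map) (G := (A.compMap w).map)
    (fun c => ⟨𝟙 c.left, η.cell.nat.app c.right, by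
      change A.right.func.map (𝟙 c.left) ≫ c.hom ≫ inv (w.leftApp c.right) =
        (c.hom ≫ inv (v.leftApp c.right)) ≫ B'.left.func.map (η.cell.nat.app c.right)
      have h := η.left c.right
      rw [CategoryTheory.Functor.map_id, Category.id_comp, Category.assoc]
      congr 1
      rw [IsIso.eq_inv_comp, IsIso.comp_inv_eq, h]⟩)
    (fun {c d} f => CommaMorphism.ext
      ((Category.comp_id f.left).trans (Category.id_comp f.left).symm)
      (η.cell.nat.naturality f.right))
    (fun c => by
      change 𝟙 _ ≫ A.apex.par.map (𝟙 c.left) = 𝟙 _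
      rw [CategoryTheory.Functor.map_id, Category.comp_id])
  left := fun c => by
    change A.left.func.map (𝟙 c.left) ≫ 𝟙 _ = 𝟙 _
    rw [CategoryTheory.Functor.map_id, Category.comp_id]
  right := fun c => η.right c.right
  comm := fun g c => CommaMorphism.ext
    (by
      change 𝟙 _ ≫ 𝟙 _ = 𝟙 _ ≫ (A.action.act g).func.map (𝟙 c.left)
      rw [CategoryTheory.Functor.map_id])
    (by
      change η.cell.nat.app c.right ≫ 𝟙 _ = 𝟙 _ ≫ η.cell.nat.app c.right
      rw [Category.comp_id, Category.id_comp])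

end InvariantSpan

section Quot

variable {G : Type} [Group G] [Finite G] {S T : ParityGroupoid.{u}}

/-- The morphism of weak quotients induced by an equivariant morphism. -/
noncomputable def Equivariance.quotient {X Y : ParityGroupoid.{u}} {a : PAction G X}
    {b : PAction G Y} {F : X ⟶ Y} (s : Equivariance a b F) : weakQuotient a ⟶ weakQuotient b where
  func :=
    { obj := fun x => (⟨F.func.obj x.pt⟩ : QuotObj b)
      map := fun {x y} f => (⟨f.elt, F.func.map f.arr ≫ s.app f.elt y.pt⟩ : QuotHom b _ _)
      map_id := fun x => QuotHom.mk_eq (a := b) (f := F.func.map (a.oneApp x.pt) ≫ s.app 1 x.pt)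
        (f' := b.oneApp (F.func.obj x.pt)) rfl
        (by rw [eqToHom_refl, Category.comp_id, s.one_app])
      map_comp := fun {x y z} f f' => QuotHom.mk_eq (a := b)
        (f := F.func.map (f.arr ≫ (a.act f.elt).func.map f'.arr ≫ a.mulApp rfl z.pt) ≫
          s.app (f'.elt * f.elt) z.pt)
        (f' := (F.func.map f.arr ≫ s.app f.elt y.pt) ≫
          (b.act f.elt).func.map (F.func.map f'.arr ≫ s.app f'.elt z.pt) ≫ b.mulApp rfl _) rfl
        (by
          rw [eqToHom_refl, Category.comp_id]
          simp only [Functor.map_comp, Category.assoc]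
          rw [s.mul_app, reassoc_of% (s.naturality f.elt f'.arr)]) }
  cell :=
    { app := fun x => F.cell.app x.pt
      naturality := fun x y f => by
        change (X.par.map f.arr ≫ inv ((a.act f.elt).cell.app y.pt)) ≫ F.cell.app y.pt =
          F.cell.app x.pt ≫ Y.par.map (F.func.map f.arr ≫ s.app f.elt y.pt) ≫
            inv ((b.act f.elt).cell.app (F.func.obj y.pt))
        have h : inv ((a.act f.elt).cell.app y.pt) ≫ F.cell.app y.pt =
            F.cell.app _ ≫ Y.par.map (s.app f.elt y.pt) ≫
              inv ((b.act f.elt).cell.app (F.func.obj y.pt)) := by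
          rw [IsIso.inv_comp_eq, reassoc_of% (s.compat f.elt y.pt), IsIso.hom_inv_id]
          exact (Category.comp_id _).symm
        rw [Category.assoc, h, Functor.map_comp, Category.assoc,
          reassoc_of% (cell_naturality F f.arr)] }

/-- The morphism out of the weak quotient induced by a cocone under the action. -/
noncomputable def Invariance.desc {X Y : ParityGroupoid.{u}} {a : PAction G X}
    {F : X ⟶ Y} (t : Invariance a F) : weakQuotient a ⟶ Y where
  func :=
    { obj := fun x => F.func.obj x.pt
      map := fun {x y} f => F.func.map f.arr ≫ t.app f.elt y.pt
      map_id := fun x => t.one_app x.pt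
      map_comp := fun {x y z} f f' => by
        change F.func.map (f.arr ≫ (a.act f.elt).func.map f'.arr ≫ a.mulApp rfl z.pt) ≫
          t.app (f'.elt * f.elt) z.pt = (F.func.map f.arr ≫ t.app f.elt y.pt) ≫
            F.func.map f'.arr ≫ t.app f'.elt z.pt
        simp only [Functor.map_comp, Category.assoc]
        rw [t.mul_app, reassoc_of% (t.naturality f.elt f'.arr)] }
  cell :=
    { app := fun x => F.cell.app x.pt
      naturality := fun x y f => by
        change (X.par.map f.arr ≫ inv ((a.act f.elt).cell.app y.pt)) ≫ F.cell.app y.pt =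
          F.cell.app x.pt ≫ Y.par.map (F.func.map f.arr ≫ t.app f.elt y.pt)
        rw [Functor.map_comp, ← reassoc_of% (cell_naturality F f.arr), Category.assoc]
        congr 1
        rw [IsIso.inv_comp_eq, t.compat] }

namespace InvariantSpan

/-- The quotient of an invariant span `S ⟵ A ⟶ T`: the span `S/G ⟵ A/G ⟶ T`. -/
noncomputable def quotient {a : PAction G S} (A : InvariantSpan a T) :
    PSpan (weakQuotient a) T where
  apex := weakQuotient A.action
  left := A.equivariance.quotient
  right := A.invariance.desc

/-- The span `S = S ⟶ S/G` given by the quotient map, with the 2-cells given by the new arrows. -/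
noncomputable def ofQuotientMap (a : PAction G S) : InvariantSpan a (weakQuotient a) where
  apex := S
  left := 𝟙 S
  right := quotientMap a
  action := a
  equivariance :=
    { cell := fun g => mkCell (F := a.act g ≫ 𝟙 S) (G := 𝟙 S ≫ a.act g)
        (fun x => 𝟙 ((a.act g).func.obj x))
        (fun f => (Category.comp_id ((a.act g).func.map f)).trans
          (Category.id_comp ((a.act g).func.map f)).symm)
        (fun x => by
          change ((a.act g).cell.app x ≫ 𝟙 _) ≫ S.par.map (𝟙 _) = 𝟙 _ ≫ (a.act g).cell.app x
          rw [CategoryTheory.Functor.map_id, Category.comp_id]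
          exact (Category.comp_id _).trans (Category.id_comp _).symm)
      one := fun x => Category.comp_id (a.oneApp x)
      mul := fun {g h m} e x => by
        change a.mulApp e x ≫ 𝟙 _ = 𝟙 _ ≫ (a.act h).func.map (𝟙 _) ≫ a.mulApp e x
        simp }
  invariance :=
    { cell := fun g => mkCell (fun x => newArrow a g x)
        (fun {x y} f => QuotHom.mk_eq (a := a)
          (f := ((a.act g).func.map f ≫ a.oneApp _) ≫ (a.act 1).func.map (𝟙 _) ≫ a.mulApp rfl y)
          (f' := 𝟙 _ ≫ (a.act g).func.map (f ≫ a.oneApp y) ≫ a.mulApp rfl y)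
          ((_root_.mul_one g).trans (_root_.one_mul g).symm) (by
            simp only [Functor.map_comp, CategoryTheory.Functor.map_id, Category.id_comp,
              Category.assoc]
            rw [reassoc_of% (a.oneApp_mulApp (x := y) (rfl : g * 1 = _) (_root_.mul_one g).symm),
              a.map_oneApp_mulApp rfl (_root_.one_mul g).symm, eqToHom_trans]))
        (fun x => by
          change ((a.act g).cell.app x ≫ 𝟙 _) ≫ S.par.map (𝟙 _) ≫
            inv ((a.act g).cell.app x) = 𝟙 _
          rw [CategoryTheory.Functor.map_id, Category.comp_id]
          exact (congrArg (_ ≫ ·) (Category.id_comp _)).trans (IsIso.hom_inv_id _))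
      one := fun x => QuotHom.mk_eq (a := a)
        (f := (a.oneApp x ≫ a.oneApp _) ≫ (a.act 1).func.map (𝟙 _) ≫ a.mulApp rfl x)
        (f' := a.oneApp x) (_root_.mul_one 1) (by
          simp only [CategoryTheory.Functor.map_id, Category.id_comp, Category.assoc]
          rw [reassoc_of% (a.oneApp_mulApp (x := x) (rfl : (1 : G) * 1 = _)
            (_root_.mul_one 1).symm), eqToHom_trans, eqToHom_refl, Category.comp_id])
      mul := fun {g h m} e x => QuotHom.mk_eq (a := a)
        (f := (a.mulApp e x ≫ a.oneApp _) ≫ (a.act 1).func.map (𝟙 _) ≫ a.mulApp rfl x)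
        (f' := 𝟙 _ ≫ (a.act h).func.map (𝟙 _) ≫ a.mulApp rfl x)
        ((_root_.mul_one m).trans e.symm) (by
          simp only [CategoryTheory.Functor.map_id, Category.id_comp, Category.assoc]
          rw [reassoc_of% (a.oneApp_mulApp (x := x) (rfl : m * 1 = _) (_root_.mul_one m).symm),
            eqToHom_trans, a.mulApp_eqToHom e e.symm]) }

end InvariantSpan

end Quot

/-- The alternating linear functor `q_!` from the `k`-fold tensor power of the slice over `X` to
its exterior power, the slice over `Λ^k X`. -/
noncomputable def qShriek (X : ParityGroupoid.{u}) (k : ℕ) :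
    AlternatingSpan X k (exteriorPower X k) :=
  InvariantSpan.ofQuotientMap (signedAction X k)

namespace InvariantSpan

variable {G : Type} [Group G] {S : ParityGroupoid.{u}} {a : PAction G S}
  {T W : ParityGroupoid.{u}}

/-- A factorization of an invariant span `A` through an invariant span `Q`: a linear functor `span`
and an equivalence of invariant spans between `A` and the composite of `Q` with `span`. -/
structure Factorization (Q : InvariantSpan a T) (A : InvariantSpan a W) : Type (u + 1) where
  span : PSpan T W
  hom : Hom A (Q.comp span)
  isEquivalence : hom.IsEquivalence

namespace Factorization

variable {Q : InvariantSpan a T} {A : InvariantSpan a W}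

/-- Equivalences of factorizations: equivalences between the linear functors, compatible up to a
specified 2-cell with the equivalences from `A`. -/
structure Equivalence (F F' : Factorization Q A) : Type u where
  hom : PSpan.Hom F.span F'.span
  isEquivalence : hom.IsEquivalence
  cell : InvariantSpan.Hom₂ (F.hom.comp (Q.compMap hom)) F'.hom

/-- 2-cells between parallel equivalences of factorizations. -/
structure Equivalence.Hom {F F' : Factorization Q A} (e e' : Equivalence F F') : Type u where
  cell : PSpan.Hom₂ e.hom e'.hom
  comm : ∀ x : A.apex.carrier,
    (Q.compMap₂ cell).cell.nat.app (F.hom.map.func.obj x) ≫ e'.cell.cell.nat.app x =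
      e.cell.cell.nat.app x

end Factorization

/-- An invariant span `Q` is universal if every invariant span `A` factors through it, uniquely:
any two factorizations are related by an equivalence, which is itself unique up to a unique
2-cell (so the 2-groupoid of factorizations is contractible). -/
def IsUniversal (Q : InvariantSpan a T) : Prop :=
  ∀ (W : ParityGroupoid.{u}) (A : InvariantSpan a W),
    Nonempty (Factorization Q A) ∧
    ∀ F F' : Factorization Q A,
      Nonempty (Factorization.Equivalence F F') ∧
      ∀ e e' : Factorization.Equivalence F F',
        Nonempty (Unique (Factorization.Equivalence.Hom e e'))

end InvariantSpan

end ParityLin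

namespace ParityLin

open ParityGroupoid

/-! The argument is descent along `q : S ⟶ S/G`, valid for any finite group `G` acting on a parity
groupoid `S`. Symmetric groups and signs enter only when `S = X^k` with the signed action is
substituted at the end.

An arrow `s ⟶ s'` of `S/G` is the same as a group element `g` with an arrow `s ⟶ s'.g` of `S`. Hence
a point of `S ×_{S/G} A/G` lying over `[x]` carries an element `g`, and is isomorphic to the image
of `x.g`. Arrows between points coming from `A` have trivial group part, hence come from `A`. So `A
≃ S ×_{S/G} A/G` (`toCompQuotient_isEquivalence`), which gives existence and the explicit form of
the factorization.

For uniqueness, let `φ : A ≃ S ×_{S/G} M` be any factorization. Since `G` acts on the pullback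
through `S` only, the projection to `M` is invariant and descends to a morphism of spans `A/G ⟶ M`.
This is an equivalence (`descMap_isEquivalence`): the square of the pullback recovers the group
element, and full faithfulness of `φ` does the rest. Every factoring span is thus identified with
`A/G`, and two of them are compared through it.

The 2-cell attached to an equivalence of factorizations has a component in `S` and one in `M`. The
first is forced by the left legs. The second descends to `A/G`, so for two equivalences the quotient
of their second components is a natural transformation on `A/G`, which extends uniquely along `A/G ≃
M` to the required 2-cell (`nonempty_hom`, `subsingleton_hom`). -/

theorem exists_comp_eq {X : ParityGroupoid.{u}} {x y z : X.carrier} (f : x ⟶ y) (h : z ⟶ y) :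
    ∃ l, l ≫ f = h := ⟨h ≫ inv f, by simp⟩

/-! ### Calculus of old and new arrows in a weak quotient. -/

section Quot

variable {G : Type} [Group G] {X : ParityGroupoid.{u}} (a : PAction G X)

/-- An old arrow has group part `1`, so the unit coherence absorbs it and only the arrow of `X`
changes. The other composition rules for old arrows follow from this one. -/
theorem oldArrow_comp {x y : X.carrier} (f : x ⟶ y) {z : QuotObj a}
    (r : (⟨y⟩ : QuotObj a) ⟶ z) :
    oldArrow a f ≫ r = (⟨r.elt, f ≫ r.arr⟩ : QuotHom a ⟨x⟩ z) :=
  QuotHom.mk_eq (a := a)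
    (f := (f ≫ a.oneApp y) ≫ (a.act 1).func.map r.arr ≫ a.mulApp rfl z.pt)
    (f' := f ≫ r.arr) (_root_.mul_one r.elt) (by
      simp only [Category.assoc]
      rw [← reassoc_of% (a.oneApp_naturality r.arr),
        reassoc_of% (a.oneApp_mulApp (x := z.pt) (rfl : r.elt * 1 = _)
          (_root_.mul_one r.elt).symm)]
      simp)

/-- Both arrows have group part `1`, and the unit component `y ⟶ y.1` can be cancelled. Freeness of
this kind makes the comparison with the pullback faithful. -/
theorem oldArrow_injective {x y : X.carrier} {f f' : x ⟶ y}
    (h : oldArrow a f = oldArrow a f') : f = f' := by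
  have h' : f ≫ a.oneApp y = f' ≫ a.oneApp y := by
    have := congrArg (fun r : QuotHom a ⟨x⟩ ⟨y⟩ =>
      (⟨r.elt, r.arr⟩ : Σ g : G, (x ⟶ (a.act g).func.obj y))) h
    exact eq_of_heq (Sigma.mk.inj this).2
  exact (cancel_mono _).1 h'

/-- Read from right to left, this factors every arrow of `X/G` as an old arrow followed by a new
one, so these two kinds generate. -/
theorem oldArrow_comp_newArrow {x y : X.carrier} (g : G) (f : x ⟶ (a.act g).func.obj y) :
    oldArrow a f ≫ newArrow a g y = (⟨g, f⟩ : QuotHom a ⟨x⟩ ⟨y⟩) :=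
  (oldArrow_comp a f (newArrow a g y)).trans
    (congrArg (QuotHom.mk (a := a) g) (Category.comp_id f))

theorem oldArrow_id (x : X.carrier) : oldArrow a (𝟙 x) = 𝟙 (⟨x⟩ : QuotObj a) :=
  QuotHom.mk_eq (a := a) (f := 𝟙 x ≫ a.oneApp x) (f' := a.oneApp x) rfl (by simp)

theorem oldArrow_comp_oldArrow {x y z : X.carrier} (f : x ⟶ y) (f' : y ⟶ z) :
    oldArrow a f ≫ oldArrow a f' = oldArrow a (f ≫ f') :=
  (oldArrow_comp a f (oldArrow a f')).trans
    (congrArg (QuotHom.mk (a := a) 1) (Category.assoc f f' _).symm)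

theorem oldArrow_comp_inv_oneApp {x y : X.carrier} (k : x ⟶ (a.act 1).func.obj y) :
    oldArrow a (k ≫ inv (a.oneApp y)) = (⟨1, k⟩ : QuotHom a ⟨x⟩ ⟨y⟩) :=
  congrArg (QuotHom.mk (a := a) 1) (by simp)

theorem weakQuotient_par_map_id [Finite G] (x : X.carrier) :
    (weakQuotient a).par.map (𝟙 (⟨x⟩ : QuotObj a)) = 𝟙 (X.par.obj x) :=
  (weakQuotient a).par.map_id (⟨x⟩ : QuotObj a)

theorem newArrow_naturality [Finite G] (g : G) {x y : X.carrier} (f : x ⟶ y) :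
    newArrow a g x ≫ oldArrow a f = oldArrow a ((a.act g).func.map f) ≫ newArrow a g y :=
  ((InvariantSpan.ofQuotientMap a).invariance.naturality g f).symm

end Quot

namespace Equivariance

variable {G : Type} [Group G] [Finite G] {X Y : ParityGroupoid.{u}} {a : PAction G X}
  {b : PAction G Y} {F : X ⟶ Y} (s : Equivariance a b F)

theorem quotient_map_eq {x y : X.carrier} (g : G)
    (f : x ⟶ (a.act g).func.obj y) :
    s.quotient.func.map (⟨g, f⟩ : QuotHom a ⟨x⟩ ⟨y⟩) =
      (⟨g, F.func.map f ≫ s.app g y⟩ : QuotHom b ⟨F.func.obj x⟩ ⟨F.func.obj y⟩) := rfl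

theorem quotient_map_oldArrow {x y : X.carrier} (f : x ⟶ y) :
    s.quotient.func.map (oldArrow a f) = oldArrow b (F.func.map f) :=
  congrArg (QuotHom.mk (a := b) 1) (by
    change F.func.map (f ≫ a.oneApp y) ≫ s.app 1 y = F.func.map f ≫ b.oneApp (F.func.obj y)
    rw [Functor.map_comp, Category.assoc, s.one_app])

theorem quotient_map_newArrow (g : G) (x : X.carrier) :
    s.quotient.func.map (newArrow a g x) = oldArrow b (s.app g x) ≫ newArrow b g (F.func.obj x) :=
  (congrArg (QuotHom.mk (a := b) g) (by
    change F.func.map (𝟙 ((a.act g).func.obj x)) ≫ s.app g x = s.app g x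
    rw [CategoryTheory.Functor.map_id, Category.id_comp])).trans
    (oldArrow_comp_newArrow b g (s.app g x)).symm

end Equivariance

/-! ### Existence: the comparison of `A` with `S ×_{S/G} A/G`. -/

namespace InvariantSpan

variable {G : Type} [Group G] [Finite G] {S T : ParityGroupoid.{u}} {a : PAction G S}

/-- The underlying morphism of the comparison of an invariant span `S ⟵ A ⟶ T` with the composite
of the quotient map and `S/G ⟵ A/G ⟶ T`, sending `x` to the triple `(s x, [x], 𝟙)`. -/
noncomputable def toCompQuotientMap (A : InvariantSpan a T) :
    A.apex ⟶ pullback (ofQuotientMap a).right A.quotient.left where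
  func :=
    { obj := fun x => (⟨A.left.func.obj x, (⟨x⟩ : QuotObj A.action),
        𝟙 (⟨A.left.func.obj x⟩ : QuotObj a)⟩ :
        Comma (quotientMap a).func A.equivariance.quotient.func)
      map := fun f => ⟨A.left.func.map f, oldArrow A.action f,
        (Category.comp_id (oldArrow a (A.left.func.map f))).trans
          ((A.equivariance.quotient_map_oldArrow f).symm.trans (Category.id_comp _).symm)⟩
      map_id := fun x => CommaMorphism.ext (A.left.func.map_id x) (oldArrow_id A.action x)
      map_comp := fun f f' => CommaMorphism.ext (A.left.func.map_comp f f')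
        (oldArrow_comp_oldArrow A.action f f').symm }
  cell :=
    -- The parity of the pullback is read off its first projection, so the cell over `P` is that of
    -- the left leg `s`.
    { app := fun x => A.left.cell.app x
      naturality := fun _ _ f => A.left.cell.naturality f }

/-- The second projection of the pullback divides by the cell of the induced left leg, which equals
the cell of `s` contributed by the comparison. The two cancel, leaving the trivial cell of the
quotient map. -/
theorem toCompQuotientMap_snd_cell (A : InvariantSpan a T) (x : A.apex.carrier) :
    A.left.cell.app x ≫ 𝟙 _ ≫ (weakQuotient a).par.map (𝟙 (⟨A.left.func.obj x⟩ : QuotObj a)) ≫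
      inv (A.left.cell.app x) = 𝟙 (A.apex.par.obj x) :=
  (congrArg (fun r => A.left.cell.app x ≫ 𝟙 _ ≫ r ≫ inv (A.left.cell.app x))
    (weakQuotient_par_map_id a _)).trans (by simp)

/-- The comparison of an invariant span with the composite of the quotient map and its quotient. -/
noncomputable def toCompQuotient (A : InvariantSpan a T) :
    Hom A ((ofQuotientMap a).comp A.quotient) where
  map := A.toCompQuotientMap
  leftCell := mkCell (fun x => 𝟙 (A.left.func.obj x))
    (fun f => (Category.comp_id (A.left.func.map f)).trans (Category.id_comp _).symm)
    (fun x => by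
      change (A.left.cell.app x ≫ 𝟙 _ ≫ 𝟙 _) ≫ S.par.map (𝟙 _) = A.left.cell.app x
      simp)
  rightCell := mkCell (fun x => 𝟙 (A.right.func.obj x))
    (fun {x y} f => by
      change (A.right.func.map (f ≫ A.action.oneApp y) ≫ A.invariance.app 1 y) ≫ 𝟙 _ =
        𝟙 _ ≫ A.right.func.map f
      rw [Functor.map_comp, Category.assoc, Category.assoc,
        reassoc_of% (A.invariance.one_app y)]
      simp)
    (fun x => by
      change (A.left.cell.app x ≫ (𝟙 _ ≫ (weakQuotient a).par.map (𝟙 _) ≫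
        inv (A.left.cell.app x)) ≫ A.right.cell.app x) ≫ T.par.map (𝟙 _) = A.right.cell.app x
      rw [CategoryTheory.Functor.map_id]
      refine (Category.comp_id _).trans ((Category.assoc _ _ _).symm.trans ?_)
      exact (congrArg (· ≫ A.right.cell.app x) (A.toCompQuotientMap_snd_cell x)).trans
        (Category.id_comp _))
  equivariance :=
    { cell := fun g => mkCell (F := A.action.act g ≫ A.toCompQuotientMap)
        (G := A.toCompQuotientMap ≫ compAct (ofQuotientMap a) A.quotient g)
        -- The group moves only the coordinate in `S`, so the coordinate `[x.g]` must be brought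
        -- back to `[x]`; the new arrow does this.
        (fun x => ⟨A.equivariance.app g x, newArrow A.action g x, by
          refine Eq.trans ?_ (Category.id_comp _).symm
          refine Eq.trans ?_ (A.equivariance.quotient_map_newArrow g x).symm
          exact congrArg (oldArrow a (A.equivariance.app g x) ≫ ·)
            (Category.comp_id (newArrow a g (A.left.func.obj x)))⟩)
        (fun {x y} f => CommaMorphism.ext (A.equivariance.naturality g f)
          (newArrow_naturality A.action g f).symm)
        (fun x => (Category.assoc _ _ _).trans (A.equivariance.compat g x))
      one := fun x => CommaMorphism.ext (A.equivariance.one_app x)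
        ((ofQuotientMap A.action).invariance.one_app x)
      mul := fun {g h m} e x => CommaMorphism.ext (A.equivariance.mul_app e x)
        (((ofQuotientMap A.action).invariance.mul_app e x).trans
          (congrArg (newArrow A.action h _ ≫ ·) (Category.comp_id (newArrow A.action g x)).symm)) }
  left_comp := fun g x => by
    change A.equivariance.app g x ≫ 𝟙 _ ≫ (a.act g).func.map (𝟙 _) =
      𝟙 _ ≫ A.equivariance.app g x
    simp
  right_comp := fun g x => by
    change (A.right.func.map (𝟙 _) ≫ A.invariance.app g x) ≫ 𝟙 _ ≫ 𝟙 _ =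
      𝟙 _ ≫ A.invariance.app g x
    simp

/-- The induced map `A/G ⟶ S/G` leaves group parts unchanged. An arrow between two image points
therefore has group part `1` in both coordinates and comes from `A`. A general point, with
connecting arrow of group part `g` over `[x]`, is reached from `x.g`. -/
theorem toCompQuotient_isEquivalence (A : InvariantSpan a T) :
    A.toCompQuotient.IsEquivalence where
  faithful := ⟨fun {x y} f f' h =>
    oldArrow_injective A.action (congrArg CommaMorphism.right h)⟩
  full := ⟨fun {x y} r => by
    obtain ⟨l, ⟨g, k⟩, w⟩ := r
    have w' : oldArrow a l =
        (⟨g, A.left.func.map k ≫ A.equivariance.app g y⟩ : QuotHom a ⟨_⟩ ⟨_⟩) :=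
      (Category.comp_id (oldArrow a l)).symm.trans (w.trans (Category.id_comp _))
    -- The connecting arrows are identities, so the square equates an old arrow with one of group
    -- part `g`.
    have hg : 1 = g := congrArg QuotHom.elt w'
    subst hg
    obtain ⟨f, hk⟩ : ∃ f : x ⟶ y,
        oldArrow A.action f = (⟨1, k⟩ : QuotHom A.action ⟨x⟩ ⟨y⟩) :=
      ⟨_, oldArrow_comp_inv_oneApp A.action k⟩
    refine ⟨f, CommaMorphism.ext (oldArrow_injective a ?_) hk⟩
    refine Eq.trans ?_ w'.symm
    exact (A.equivariance.quotient_map_oldArrow _).symm.trans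
      (congrArg (fun r => A.equivariance.quotient.func.map r) hk)⟩
  essSurj := ⟨fun c => by
    obtain ⟨z, ⟨x⟩, r⟩ := c
    obtain ⟨g, f⟩ : QuotHom a ⟨z⟩ ⟨A.left.func.obj x⟩ := r
    -- The arrow `l` is the equivariance cell corrected by `f`, so that with the new arrow for `g`
    -- it forms a commuting square.
    obtain ⟨l, hl⟩ : ∃ l : A.left.func.obj ((A.action.act g).func.obj x) ⟶ z,
        l ≫ f = A.equivariance.app g x :=
      exists_comp_eq (X := S) f _
    refine ⟨(A.action.act g).func.obj x, ⟨(Groupoid.isoEquivHom _ _).symm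
      (CommaMorphism.mk l (newArrow A.action g x) ?_)⟩⟩
    refine Eq.trans ?_ (Category.id_comp _).symm
    refine Eq.trans (oldArrow_comp a _ _) (Eq.trans ?_
      (A.equivariance.quotient_map_eq g (𝟙 _)).symm)
    exact congrArg (QuotHom.mk (a := a) g) (by
      change l ≫ f = A.left.func.map (𝟙 _) ≫ A.equivariance.app g x
      rw [hl, CategoryTheory.Functor.map_id, Category.id_comp])⟩

/-- The second projection of the composite with the quotient span, restricted along the comparison,
is the quotient map. -/
noncomputable def toCompQuotientSnd (A : InvariantSpan a T) :
    A.toCompQuotient.map ≫ pullbackSnd (ofQuotientMap a).right A.quotient.left ⟶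
      quotientMap A.action :=
  mkCell (fun x => 𝟙 (⟨x⟩ : QuotObj A.action))
    (fun f => (Category.comp_id (oldArrow A.action f)).trans (Category.id_comp _).symm)
    (fun x => by
      change (A.left.cell.app x ≫ 𝟙 _ ≫ (weakQuotient a).par.map (𝟙 _) ≫
        inv (A.left.cell.app x)) ≫ (weakQuotient A.action).par.map (𝟙 _) = 𝟙 _
      exact (congrArg (_ ≫ ·) (weakQuotient_par_map_id A.action x)).trans
        ((Category.comp_id _).trans (A.toCompQuotientMap_snd_cell x)))

end InvariantSpan

/-! ### The universal property of the quotient map, on 2-cells and on cocones. -/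

section Quot

variable {G : Type} [Group G] [Finite G] {X Y Z : ParityGroupoid.{u}} (a : PAction G X)

/-- The 2-cells exhibiting the quotient map `X ⟶ X/G` as a cocone under the action. -/
noncomputable def quotientMapInvariance : Invariance a (quotientMap a) :=
  (InvariantSpan.ofQuotientMap a).invariance

theorem quotientMap_hom_decomp {x y : X.carrier}
    (r : (quotientMap a).func.obj x ⟶ (quotientMap a).func.obj y) :
    ∃ (g : G) (k : x ⟶ (a.act g).func.obj y),
      (quotientMap a).func.map k ≫ (quotientMapInvariance a).app g y = r := by
  obtain ⟨g, k⟩ : QuotHom a ⟨x⟩ ⟨y⟩ := r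
  exact ⟨g, k, oldArrow_comp_newArrow a g k⟩

/-- Equality in the sigma type keeps the group elements and the arrows together; this is how a group
element is recovered from an equation in `X/G`. -/
theorem quotientMap_hom_unique {x y : X.carrier} {g g' : G} {k : x ⟶ (a.act g).func.obj y}
    {k' : x ⟶ (a.act g').func.obj y}
    (h : (quotientMap a).func.map k ≫ (quotientMapInvariance a).app g y =
      (quotientMap a).func.map k' ≫ (quotientMapInvariance a).app g' y) :
    (⟨g, k⟩ : Σ g : G, (x ⟶ (a.act g).func.obj y)) = ⟨g', k'⟩ :=
  congrArg (fun r : QuotHom a ⟨x⟩ ⟨y⟩ =>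
      (⟨r.elt, r.arr⟩ : Σ g : G, (x ⟶ (a.act g).func.obj y)))
    ((oldArrow_comp_newArrow a g k).symm.trans (h.trans (oldArrow_comp_newArrow a g' k')))

/-- Old and new arrows generate `X/G`, so naturality has to be tested only on them. All later
2-cells on a weak quotient are obtained this way. -/
theorem weakQuotient_naturality {C : Type*} [Category C] {F H : (weakQuotient a).carrier ⥤ C}
    (α : ∀ x : X.carrier,
      F.obj ((quotientMap a).func.obj x) ⟶ H.obj ((quotientMap a).func.obj x))
    (h₁ : ∀ {x y : X.carrier} (f : x ⟶ y), F.map ((quotientMap a).func.map f) ≫ α y =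
      α x ≫ H.map ((quotientMap a).func.map f))
    (h₂ : ∀ (g : G) (x : X.carrier), F.map ((quotientMapInvariance a).app g x) ≫ α x =
      α ((a.act g).func.obj x) ≫ H.map ((quotientMapInvariance a).app g x))
    {x y : X.carrier} (r : (quotientMap a).func.obj x ⟶ (quotientMap a).func.obj y) :
    F.map r ≫ α y = α x ≫ H.map r := by
  obtain ⟨g, k, rfl⟩ := quotientMap_hom_decomp a r
  rw [Functor.map_comp, Functor.map_comp, Category.assoc, h₂, reassoc_of% (h₁ k)]

variable {a} {b : PAction G Y} {F : X ⟶ Y}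

theorem Equivariance.quotient_map_quotientMap (s : Equivariance a b F) {x y : X.carrier}
    (f : x ⟶ y) :
    s.quotient.func.map ((quotientMap a).func.map f) = (quotientMap b).func.map (F.func.map f) :=
  s.quotient_map_oldArrow f

theorem Equivariance.quotient_map_app (s : Equivariance a b F) (g : G) (x : X.carrier) :
    s.quotient.func.map ((quotientMapInvariance a).app g x) =
      (quotientMap b).func.map (s.app g x) ≫
        (quotientMapInvariance b).app g (F.func.obj x) :=
  s.quotient_map_newArrow g x

/-- The factorization through the quotient is strict: an equality of maps, by the unit law of the
cocone. -/
theorem Invariance.desc_map_quotientMap (t : Invariance a F) {x y : X.carrier} (f : x ⟶ y) :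
    t.desc.func.map ((quotientMap a).func.map f) = F.func.map f := by
  change F.func.map (f ≫ a.oneApp y) ≫ t.app 1 y = F.func.map f
  rw [Functor.map_comp, Category.assoc, t.one_app, Category.comp_id]

theorem Invariance.desc_map_app (t : Invariance a F) (g : G) (x : X.carrier) :
    t.desc.func.map ((quotientMapInvariance a).app g x) = t.app g x := by
  change F.func.map (𝟙 _) ≫ t.app g x = t.app g x
  rw [CategoryTheory.Functor.map_id, Category.id_comp]

/-- Restriction of a cocone along an equivariant morphism. -/
def Equivariance.compInvariance (s : Equivariance a b F) {H : Y ⟶ Z} (t : Invariance b H) :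
    Invariance a (F ≫ H) where
  cell g := mkCell (F := a.act g ≫ F ≫ H) (G := F ≫ H)
    (fun x => H.func.map (s.app g x) ≫ t.app g (F.func.obj x))
    (fun {x y} f => by
      change H.func.map (F.func.map ((a.act g).func.map f)) ≫ H.func.map (s.app g y) ≫ _ =
        (H.func.map (s.app g x) ≫ t.app g (F.func.obj x)) ≫ H.func.map (F.func.map f)
      rw [← Functor.map_comp_assoc, s.naturality, Functor.map_comp_assoc, t.naturality,
        Category.assoc])
    (fun x => by
      change ((a.act g).cell.app x ≫ F.cell.app _ ≫ H.cell.app _) ≫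
        Z.par.map (H.func.map (s.app g x) ≫ t.app g (F.func.obj x)) =
          F.cell.app x ≫ H.cell.app (F.func.obj x)
      have h := cell_naturality H (s.app g x)
      rw [Functor.map_comp, Category.assoc, Category.assoc, ← reassoc_of% h,
        reassoc_of% (s.compat g x), t.compat])
  one x := by
    change H.func.map (F.func.map (a.oneApp x)) ≫ H.func.map (s.app 1 x) ≫ _ = _
    rw [← Functor.map_comp_assoc, s.one_app, t.one_app]
    rfl
  mul {g h m} e x := by
    change H.func.map (F.func.map (a.mulApp e x)) ≫ H.func.map (s.app m x) ≫ t.app m _ =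
      (H.func.map (s.app h _) ≫ t.app h _) ≫ H.func.map (s.app g x) ≫ t.app g _
    rw [← Functor.map_comp_assoc, s.mul_app, Functor.map_comp_assoc, Functor.map_comp_assoc,
      t.mul_app, reassoc_of% (t.naturality h (s.app g x)), Category.assoc]

end Quot

/-! ### Morphisms from `A` into a composite with the quotient map, by components. -/

namespace InvariantSpan

variable {G : Type} [Group G] {S T W : ParityGroupoid.{u}} {a : PAction G S}

/-- The second projection of a composite is a cocone under the action. -/
noncomputable def compSndInvariance (A : InvariantSpan a T) (B : PSpan T W) :
    Invariance (A.compAction B) (pullbackSnd A.right B.left) where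
  cell g := mkCell (F := compAct A B g ≫ pullbackSnd A.right B.left)
    -- The action on the pullback fixes the second coordinate, so the cocone cells are identities.
    (fun c => 𝟙 c.right)
    (fun {c d} f => (Category.comp_id (CommaMorphism.right f)).trans
      (Category.id_comp (CommaMorphism.right f)).symm)
    (fun c => by
      change ((A.action.act g).cell.app c.left ≫ A.right.cell.app _ ≫
        T.par.map (A.invariance.app g c.left ≫ c.hom) ≫ inv (B.left.cell.app c.right)) ≫
          B.apex.par.map (𝟙 c.right) =
        A.right.cell.app c.left ≫ T.par.map c.hom ≫ inv (B.left.cell.app c.right)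
      rw [CategoryTheory.Functor.map_id, Functor.map_comp]
      refine (Category.comp_id _).trans ?_
      rw [Category.assoc, reassoc_of% (A.invariance.compat g c.left)])
  one c := by
    change 𝟙 c.right ≫ 𝟙 c.right = 𝟙 c.right
    rw [Category.comp_id]
  mul _ _ := rfl

namespace Hom

variable [Finite G] {A : InvariantSpan a W} {M : PSpan (weakQuotient a) W}
  (φ : Hom A ((ofQuotientMap a).comp M))

/-- The first component of the image of a point. -/
noncomputable def fstObj (x : A.apex.carrier) : S.carrier := (φ.map.func.obj x).left

/-- The second component of the image of a point. -/
noncomputable def sndObj (x : A.apex.carrier) : M.apex.carrier := (φ.map.func.obj x).right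

/-- The arrow component of the image of a point. -/
noncomputable def arrow (x : A.apex.carrier) :
    (quotientMap a).func.obj (φ.fstObj x) ⟶ M.left.func.obj (φ.sndObj x) :=
  (φ.map.func.obj x).hom

/-- The first component of the image of an arrow. -/
noncomputable def fstMap {x y : A.apex.carrier} (f : x ⟶ y) : φ.fstObj x ⟶ φ.fstObj y :=
  (φ.map.func.map f).left

/-- The second component of the image of an arrow. -/
noncomputable def sndMap {x y : A.apex.carrier} (f : x ⟶ y) : φ.sndObj x ⟶ φ.sndObj y :=
  (φ.map.func.map f).right

/-- The first component of the equivariance 2-cell. -/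
noncomputable def fstEquiv (g : G) (x : A.apex.carrier) :
    φ.fstObj ((A.action.act g).func.obj x) ⟶ (a.act g).func.obj (φ.fstObj x) :=
  (φ.equivariance.app g x).left

/-- The second component of the equivariance 2-cell. -/
noncomputable def sndEquiv (g : G) (x : A.apex.carrier) :
    φ.sndObj ((A.action.act g).func.obj x) ⟶ φ.sndObj x :=
  (φ.equivariance.app g x).right

/-- The left 2-cell. -/
noncomputable def fstLeft (x : A.apex.carrier) : φ.fstObj x ⟶ A.left.func.obj x := φ.toHom.leftApp x

/-- The right 2-cell. -/
noncomputable def sndRight (x : A.apex.carrier) :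
    M.right.func.obj (φ.sndObj x) ⟶ A.right.func.obj x := φ.toHom.rightApp x

theorem map_arrow {x y : A.apex.carrier} (f : x ⟶ y) :
    (quotientMap a).func.map (φ.fstMap f) ≫ φ.arrow y =
      φ.arrow x ≫ M.left.func.map (φ.sndMap f) :=
  (φ.map.func.map f).w

/-- The new arrow appears because `g` acts on the pullback by precomposing the connecting arrow with
the invariance cell of the quotient map. -/
theorem equiv_arrow (g : G) (x : A.apex.carrier) :
    (quotientMap a).func.map (φ.fstEquiv g x) ≫
        (quotientMapInvariance a).app g (φ.fstObj x) ≫ φ.arrow x =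
      φ.arrow ((A.action.act g).func.obj x) ≫ M.left.func.map (φ.sndEquiv g x) :=
  (φ.equivariance.app g x).w

theorem fstLeft_naturality {x y : A.apex.carrier} (f : x ⟶ y) :
    φ.fstMap f ≫ φ.fstLeft y = φ.fstLeft x ≫ A.left.func.map f :=
  φ.toHom.leftApp_naturality f

theorem sndRight_naturality {x y : A.apex.carrier} (f : x ⟶ y) :
    M.right.func.map (φ.sndMap f) ≫ φ.sndRight y = φ.sndRight x ≫ A.right.func.map f :=
  φ.toHom.rightApp_naturality f

theorem fstEquiv_left (g : G) (x : A.apex.carrier) :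
    φ.fstEquiv g x ≫ (a.act g).func.map (φ.fstLeft x) =
      φ.fstLeft ((A.action.act g).func.obj x) ≫ A.equivariance.app g x :=
  (congrArg (φ.fstEquiv g x ≫ ·) (Category.id_comp ((a.act g).func.map (φ.fstLeft x)))).symm.trans
    (φ.left_comp g x)

theorem sndEquiv_right (g : G) (x : A.apex.carrier) :
    M.right.func.map (φ.sndEquiv g x) ≫ φ.sndRight x =
      φ.sndRight ((A.action.act g).func.obj x) ≫ A.invariance.app g x :=
  (congrArg (M.right.func.map (φ.sndEquiv g x) ≫ ·)
    (Category.id_comp (φ.sndRight x))).symm.trans (φ.right_comp g x)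

/-- The second projection of a morphism into a composite, as a cocone under the action. -/
noncomputable def sndInvariance :
    Invariance A.action (φ.map ≫ pullbackSnd (ofQuotientMap a).right M.left) :=
  φ.equivariance.compInvariance (compSndInvariance (ofQuotientMap a) M)

theorem sndInvariance_app (g : G) (x : A.apex.carrier) :
    φ.sndInvariance.app g x = φ.sndEquiv g x :=
  Category.comp_id (φ.sndEquiv g x)

/-- The morphism `A/G ⟶ M` induced by the second projection. -/
noncomputable def descMap : weakQuotient A.action ⟶ M.apex := φ.sndInvariance.desc

theorem descMap_map_quotientMap {x y : A.apex.carrier} (f : x ⟶ y) :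
    φ.descMap.func.map ((quotientMap A.action).func.map f) = φ.sndMap f :=
  φ.sndInvariance.desc_map_quotientMap f

theorem descMap_map_app (g : G) (x : A.apex.carrier) :
    φ.descMap.func.map ((quotientMapInvariance A.action).app g x) = φ.sndEquiv g x :=
  (φ.sndInvariance.desc_map_app g x).trans (φ.sndInvariance_app g x)

/-- The component at `[x]` of the left 2-cell of the induced morphism of spans. -/
noncomputable def descLeft (x : A.apex.carrier) :
    M.left.func.obj (φ.sndObj x) ⟶ (quotientMap a).func.obj (A.left.func.obj x) :=
  inv (φ.arrow x) ≫ (quotientMap a).func.map (φ.fstLeft x)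

/-- With `descLeft_naturality_app` this tests naturality of the left 2-cell on old and new arrows,
which suffices on `A/G`. Both combine the pullback square with compatibility of `fstLeft`. -/
theorem descLeft_naturality_quotientMap {x y : A.apex.carrier} (f : x ⟶ y) :
    M.left.func.map (φ.sndMap f) ≫ φ.descLeft y =
      φ.descLeft x ≫ (quotientMap a).func.map (A.left.func.map f) := by
  unfold descLeft
  rw [Category.assoc, ← Functor.map_comp, ← fstLeft_naturality, Functor.map_comp,
    IsIso.eq_inv_comp, ← reassoc_of% (φ.map_arrow f), IsIso.hom_inv_id_assoc]

theorem descLeft_naturality_app (g : G) (x : A.apex.carrier) :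
    M.left.func.map (φ.sndEquiv g x) ≫ φ.descLeft x =
      φ.descLeft ((A.action.act g).func.obj x) ≫
        (quotientMap a).func.map (A.equivariance.app g x) ≫
          (quotientMapInvariance a).app g (A.left.func.obj x) := by
  unfold descLeft
  rw [Category.assoc, ← Functor.map_comp_assoc, ← fstEquiv_left, Functor.map_comp_assoc,
    IsIso.eq_inv_comp, ← reassoc_of% (φ.equiv_arrow g x), IsIso.hom_inv_id_assoc,
    (quotientMapInvariance a).naturality]

/-- The cell of the second projection was defined with an inverse of the cell of `M.left`; composing
with the latter removes it and leaves the parity of the connecting arrow. -/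
theorem snd_cell (x : A.apex.carrier) :
    φ.descMap.cell.app ((quotientMap A.action).func.obj x) ≫ M.left.cell.app (φ.sndObj x) =
      φ.map.cell.app x ≫ (quotientMap a).cell.app (φ.fstObj x) ≫
        (weakQuotient a).par.map (φ.arrow x) := by
  change (φ.map.cell.app x ≫ (quotientMap a).cell.app (φ.fstObj x) ≫
        (weakQuotient a).par.map (φ.arrow x) ≫ inv (M.left.cell.app (φ.sndObj x))) ≫
          M.left.cell.app (φ.sndObj x) = _
  simp

theorem fstLeft_compat (x : A.apex.carrier) :
    φ.map.cell.app x ≫ S.par.map (φ.fstLeft x) = A.left.cell.app x := by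
  refine Eq.trans ?_ (φ.toHom.leftApp_compat x)
  refine congrArg (φ.map.cell.app x ≫ ·) ?_
  exact ((Category.id_comp _).symm.trans (Category.id_comp _).symm).trans
    (Category.assoc _ _ _).symm

theorem descLeft_compat (x : A.apex.carrier) :
    φ.descMap.cell.app ((quotientMap A.action).func.obj x) ≫ M.left.cell.app (φ.sndObj x) ≫
        (weakQuotient a).par.map (φ.descLeft x) = A.left.cell.app x := by
  rw [reassoc_of% (φ.snd_cell x)]
  unfold descLeft
  rw [← Functor.map_comp, IsIso.hom_inv_id_assoc, ← cell_naturality]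
  exact (congrArg (φ.map.cell.app x ≫ ·) (Category.comp_id _)).trans (φ.fstLeft_compat x)

end Hom

end InvariantSpan

/-! ### The induced morphism of spans `A/G ⟶ M` and why it is an equivalence. -/

namespace InvariantSpan

namespace Hom

variable {G : Type} [Group G] {S T W : ParityGroupoid.{u}} {a : PAction G S}

variable [Finite G] {A : InvariantSpan a W} {M : PSpan (weakQuotient a) W}
  (φ : Hom A ((ofQuotientMap a).comp M))

/-- The morphism of spans from the quotient span induced by a morphism into a composite with the
quotient map. -/
noncomputable def descHom : PSpan.Hom A.quotient M where
  map := φ.descMap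
  leftCell := mkCell (F := φ.descMap ≫ M.left) (G := A.equivariance.quotient)
    (fun x => φ.descLeft x.pt)
    (fun {x y} r => weakQuotient_naturality A.action
      (F := φ.descMap.func ⋙ M.left.func) (H := A.equivariance.quotient.func)
      (fun x => φ.descLeft x)
      (fun {x y} f => by
        change M.left.func.map (φ.descMap.func.map _) ≫ _ = _
        rw [descMap_map_quotientMap, Equivariance.quotient_map_quotientMap]
        exact φ.descLeft_naturality_quotientMap f)
      (fun g x => by
        change M.left.func.map (φ.descMap.func.map _) ≫ _ = _
        rw [descMap_map_app, Equivariance.quotient_map_app]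
        exact φ.descLeft_naturality_app g x) (x := x.pt) (y := y.pt) r)
    (fun x => (Category.assoc _ _ _).trans (φ.descLeft_compat x.pt))
  rightCell := mkCell (F := φ.descMap ≫ M.right) (G := A.invariance.desc)
    (fun x => φ.sndRight x.pt)
    (fun {x y} r => weakQuotient_naturality A.action
      (F := φ.descMap.func ⋙ M.right.func) (H := A.invariance.desc.func)
      (fun x => φ.sndRight x)
      (fun {x y} f => by
        change M.right.func.map (φ.descMap.func.map _) ≫ _ = _
        rw [descMap_map_quotientMap, Invariance.desc_map_quotientMap]
        exact φ.sndRight_naturality f)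
      (fun g x => by
        change M.right.func.map (φ.descMap.func.map _) ≫ _ = _
        rw [descMap_map_app, Invariance.desc_map_app]
        exact φ.sndEquiv_right g x) (x := x.pt) (y := y.pt) r)
    (fun x => by
      refine Eq.trans ?_ (φ.toHom.rightApp_compat x.pt)
      change ((φ.map.cell.app x.pt ≫ (pullbackSnd _ _).cell.app _) ≫ _) ≫ _ =
        φ.map.cell.app x.pt ≫ ((pullbackSnd _ _).cell.app _ ≫ _) ≫ _
      simp only [Category.assoc]
      rfl)

/-- The inverse of the left 2-cell. -/
noncomputable def fstLeftInv (x : A.apex.carrier) : A.left.func.obj x ⟶ φ.fstObj x :=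
  inv (φ.fstLeft x)

theorem fstLeftInv_compat (x : A.apex.carrier) :
    A.left.cell.app x ≫ S.par.map (φ.fstLeftInv x) = φ.map.cell.app x := by
  rw [← φ.fstLeft_compat x]
  refine (Category.assoc _ _ _).trans (Eq.trans (congrArg (φ.map.cell.app x ≫ ·) ?_)
    (Category.comp_id _))
  exact (S.par.map_comp _ _).symm.trans
    ((congrArg (fun r => S.par.map r) (IsIso.hom_inv_id (φ.fstLeft x))).trans (S.par.map_id _))

theorem exists_fstMap_sndMap_eq {x y : A.apex.carrier} (hφ : φ.IsEquivalence)
    (l : φ.fstObj x ⟶ φ.fstObj y) (r : φ.sndObj x ⟶ φ.sndObj y)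
    (w : (quotientMap a).func.map l ≫ φ.arrow y = φ.arrow x ≫ M.left.func.map r) :
    ∃ f : x ⟶ y, φ.fstMap f = l ∧ φ.sndMap f = r := by
  have := hφ.full
  obtain ⟨f, hf⟩ := φ.map.func.map_surjective (CommaMorphism.mk l r w)
  exact ⟨f, congrArg CommaMorphism.left hf, congrArg CommaMorphism.right hf⟩

theorem arrow_ext {x y : A.apex.carrier} (hφ : φ.IsEquivalence) {f f' : x ⟶ y}
    (h₁ : φ.fstMap f = φ.fstMap f') (h₂ : φ.sndMap f = φ.sndMap f') : f = f' := by
  have := hφ.faithful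
  exact φ.map.func.map_injective (CommaMorphism.ext h₁ h₂)

theorem descMap_map_comp {x y : A.apex.carrier} (g : G) (k : x ⟶ (A.action.act g).func.obj y) :
    φ.descMap.func.map ((quotientMap A.action).func.map k ≫
      (quotientMapInvariance A.action).app g y) = φ.sndMap k ≫ φ.sndEquiv g y :=
  (φ.descMap.func.map_comp _ _).trans
    (congrArg₂ (· ≫ ·) (φ.descMap_map_quotientMap k) (φ.descMap_map_app g y))

/-- An arrow of `M` between second components determines, through the invertible connecting arrows,
an arrow of `S/G` between first components. Its unique decomposition supplies the group element and
the arrow in `S` that `M` does not see. Full faithfulness of `φ` then applies to the resulting pair.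
-/
theorem descMap_isEquivalence (hφ : φ.IsEquivalence) : φ.descMap.func.IsEquivalence where
  faithful := ⟨fun {x y} r r' h => by
    obtain ⟨x⟩ : QuotObj A.action := x
    obtain ⟨y⟩ : QuotObj A.action := y
    obtain ⟨g, k, rfl⟩ := quotientMap_hom_decomp A.action (x := x) (y := y) r
    obtain ⟨g', k', rfl⟩ := quotientMap_hom_decomp A.action (x := x) (y := y) r'
    -- The arrow `(g, k)` of `A/G` has its image in `M` tied by this square to its image in `S/G`.
    have key (g : G) (k : x ⟶ (A.action.act g).func.obj y) :
        (quotientMap a).func.map (φ.fstMap k ≫ φ.fstEquiv g y) ≫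
          (quotientMapInvariance a).app g (φ.fstObj y) ≫ φ.arrow y =
        φ.arrow x ≫ M.left.func.map (φ.sndMap k ≫ φ.sndEquiv g y) := by
      rw [Functor.map_comp, Functor.map_comp, Category.assoc, ← reassoc_of% (φ.map_arrow k),
        ← φ.equiv_arrow g y]
    replace h := (φ.descMap_map_comp g k).symm.trans (h.trans (φ.descMap_map_comp g' k'))
    have h₀ := (key g k).trans
      ((congrArg (fun r => φ.arrow x ≫ M.left.func.map r) h).trans (key g' k').symm)
    rw [← Category.assoc, ← Category.assoc, cancel_mono] at h₀
    -- Equal images in `M` thus give equal images in `S/G`, hence equal group elements.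
    have h₁ := quotientMap_hom_unique a h₀
    obtain rfl : g = g' := congrArg Sigma.fst h₁
    have h₂ := eq_of_heq (Sigma.mk.inj h₁).2
    have : k = k' := φ.arrow_ext hφ ((cancel_mono _).1 h₂) ((cancel_mono _).1 h)
    rw [this]⟩
  full := ⟨fun {x y} h => by
    obtain ⟨x⟩ : QuotObj A.action := x
    obtain ⟨y⟩ : QuotObj A.action := y
    change φ.sndObj x ⟶ φ.sndObj y at h
    -- Conjugation by the connecting arrows turns `h` into an arrow `r` of `S/G`, whose group part
    -- is the element needed for the lift.
    obtain ⟨r, hr⟩ := exists_comp_eq (φ.arrow y) (φ.arrow x ≫ M.left.func.map h)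
    obtain ⟨g, l, rfl⟩ := quotientMap_hom_decomp a r
    -- Undoing the equivariance cells retargets both components at the image of `y.g`, where
    -- fullness of `φ` applies.
    obtain ⟨l', rfl⟩ := exists_comp_eq (φ.fstEquiv g y) l
    obtain ⟨h', rfl⟩ := exists_comp_eq (φ.sndEquiv g y) h
    rw [Functor.map_comp, Functor.map_comp, Category.assoc, Category.assoc, φ.equiv_arrow,
      ← Category.assoc, ← Category.assoc, cancel_mono] at hr
    obtain ⟨k, -, rfl⟩ := φ.exists_fstMap_sndMap_eq hφ l' h' hr
    refine ⟨(quotientMap A.action).func.map k ≫ (quotientMapInvariance A.action).app g y, ?_⟩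
    exact φ.descMap_map_comp g k⟩
  essSurj := ⟨fun m => by
    have := hφ.essSurj
    let c : Comma (quotientMap a).func M.left.func :=
      -- Every object of `S/G` is literally the class of a point of `S`, so `m` lifts to the
      -- pullback with an identity connecting arrow.
      ⟨QuotObj.pt (a := a) (M.left.func.obj m), m, 𝟙 (M.left.func.obj m)⟩
    obtain ⟨x, ⟨e⟩⟩ := this.mem_essImage c
    exact ⟨(quotientMap A.action).func.obj x, ⟨(Comma.snd _ _).mapIso e⟩⟩⟩

end Hom

end InvariantSpan

/-! ### Natural transformations along equivalences of categories. -/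

theorem natTrans_ext_of_essSurj {C D K : Type*} [Category C] [Category D] [Category K]
    (E : C ⥤ D) [E.EssSurj] {F H : D ⥤ K} {α β : F ⟶ H}
    (h : ∀ c, α.app (E.obj c) = β.app (E.obj c)) : α = β := by
  ext d
  rw [← cancel_epi (F.map (E.objObjPreimageIso d).hom), α.naturality, β.naturality, h]

/-- The value at `d` is transported from a chosen preimage, and naturality holds because `E` is
full: arrows between chosen preimages lift. -/
theorem exists_natTrans_extension {C D K : Type*} [Category C] [Category D] [Category K]
    (E : C ⥤ D) [E.IsEquivalence] {F H : D ⥤ K} (α : E ⋙ F ⟶ E ⋙ H) :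
    ∃ δ : F ⟶ H, ∀ c, δ.app (E.obj c) = α.app c := by
  refine ⟨{ app := fun d => F.map (E.objObjPreimageIso d).inv ≫ α.app (E.objPreimage d) ≫
              H.map (E.objObjPreimageIso d).hom
            naturality := fun d d' f => ?_ }, fun c => ?_⟩
  · obtain ⟨k, hk⟩ := E.map_surjective
      ((E.objObjPreimageIso d).hom ≫ f ≫ (E.objObjPreimageIso d').inv)
    have h := α.naturality k
    dsimp only [Functor.comp_map] at h
    rw [hk] at h
    simp only [Functor.map_comp, Category.assoc] at h
    rw [← cancel_mono (H.map (E.objObjPreimageIso d').inv),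
      ← cancel_epi (F.map (E.objObjPreimageIso d).hom)]
    simp only [Category.assoc, Iso.map_hom_inv_id, Iso.map_hom_inv_id_assoc]
    erw [Category.comp_id]
    exact h
  -- At an object `E c` the chosen preimage need not be `c`; lifting the comparison isomorphism to
  -- `k` shows that the value is still `α` at `c`.
  · obtain ⟨k, hk⟩ := E.map_surjective (E.objObjPreimageIso (E.obj c)).hom
    have h := α.naturality k
    dsimp only [Functor.comp_map] at h
    rw [hk] at h
    change F.map _ ≫ α.app _ ≫ H.map _ = _
    rw [← h, ← Functor.map_comp_assoc, Iso.inv_hom_id, CategoryTheory.Functor.map_id,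
      Category.id_comp]

/-! ### Inverting equivalences over `P`. -/

namespace ParityGroupoid

variable {X Y : ParityGroupoid.{u}}

/-- The inverse of a 2-cell. -/
noncomputable def invCell {F H : X ⟶ Y} (α : F ⟶ H) : H ⟶ F :=
  mkCell (fun x => inv (α.nat.app x))
    (fun f => by rw [IsIso.comp_inv_eq, Category.assoc, nat_naturality, IsIso.inv_hom_id_assoc])
    (fun x => by rw [Functor.map_inv, IsIso.comp_inv_eq, nat_compat])

/-- The component of the counit of an equivalence. -/
noncomputable def counitApp (E : X.carrier ⥤ Y.carrier) [E.IsEquivalence] (y : Y.carrier) :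
    E.obj (E.inv.obj y) ⟶ y :=
  E.asEquivalence.counitIso.hom.app y

theorem counitApp_naturality (E : X.carrier ⥤ Y.carrier) [E.IsEquivalence] {y y' : Y.carrier}
    (f : y ⟶ y') : E.map (E.inv.map f) ≫ counitApp E y' = counitApp E y ≫ f :=
  E.asEquivalence.counitIso.hom.naturality f

/-- The component of the inverse of the unit of an equivalence. -/
noncomputable def unitInvApp (E : X.carrier ⥤ Y.carrier) [E.IsEquivalence] (x : X.carrier) :
    E.inv.obj (E.obj x) ⟶ x :=
  E.asEquivalence.unitIso.inv.app x

theorem unitInvApp_naturality (E : X.carrier ⥤ Y.carrier) [E.IsEquivalence] {x x' : X.carrier}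
    (f : x ⟶ x') : E.inv.map (E.map f) ≫ unitInvApp E x' = unitInvApp E x ≫ f :=
  E.asEquivalence.unitIso.inv.naturality f

/-- A triangle identity. It makes the unit compatible with a parity cell that is defined through the
counit. -/
theorem map_unitInvApp (E : X.carrier ⥤ Y.carrier) [E.IsEquivalence] (x : X.carrier) :
    E.map (unitInvApp E x) = counitApp E (E.obj x) :=
  (E.asEquivalence.counit_app_functor x).symm

/-- An inverse of an equivalence of parity groupoids. -/
noncomputable def invHom (E : X ⟶ Y) [E.func.IsEquivalence] : Y ⟶ X where
  func := E.func.inv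
  cell :=
    -- This value is forced by asking the counit to be a 2-cell over `P`.
    { app := fun y => inv (E.cell.app (E.func.inv.obj y) ≫ Y.par.map (counitApp E.func y))
      naturality := fun _ _ f => by
        change Y.par.map f ≫ _ = _ ≫ X.par.map (E.func.inv.map f)
        rw [IsIso.comp_inv_eq, Category.assoc, IsIso.eq_inv_comp,
          reassoc_of% (cell_naturality E (E.func.inv.map f)), ← Functor.map_comp,
          counitApp_naturality, Functor.map_comp, Category.assoc] }

/-- The counit of an equivalence of parity groupoids. -/
noncomputable def counitCell (E : X ⟶ Y) [E.func.IsEquivalence] : invHom E ≫ E ⟶ 𝟙 Y :=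
  mkCell (F := invHom E ≫ E) (G := 𝟙 Y) (counitApp E.func) (counitApp_naturality E.func)
    (fun _ => (Category.assoc _ _ _).trans (IsIso.inv_hom_id _))

/-- The inverse of the unit of an equivalence of parity groupoids. -/
noncomputable def unitInvCell (E : X ⟶ Y) [E.func.IsEquivalence] : E ≫ invHom E ⟶ 𝟙 X :=
  mkCell (F := E ≫ invHom E) (G := 𝟙 X) (unitInvApp E.func) (unitInvApp_naturality E.func)
    (fun x => by
      change (E.cell.app x ≫ inv (E.cell.app (E.func.inv.obj (E.func.obj x)) ≫
        Y.par.map (counitApp E.func (E.func.obj x)))) ≫ X.par.map (unitInvApp E.func x) =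
          𝟙 (X.par.obj x)
      rw [← cancel_mono (E.cell.app x), Category.assoc, cell_naturality, map_unitInvApp,
        Category.assoc, IsIso.inv_hom_id, Category.comp_id, Category.id_comp])

end ParityGroupoid

/-! ### Extending morphisms of spans along an equivalence of spans. -/

namespace PSpan.Hom

variable {S T : ParityGroupoid.{u}} {M M' N : PSpan S T}

/-- The extension of a morphism of spans along an equivalence of spans. -/
noncomputable def extend (v : Hom N M) (v' : Hom N M') [v.map.func.IsEquivalence] : Hom M M' where
  map := invHom v.map ≫ v'.map
  leftCell := (Bicategory.associator _ _ _).hom ≫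
    whiskL (invHom v.map) (v'.leftCell ≫ invCell v.leftCell) ≫
    (Bicategory.associator _ _ _).inv ≫ whiskR (counitCell v.map) M.left ≫
    (Bicategory.leftUnitor M.left).hom
  rightCell := (Bicategory.associator _ _ _).hom ≫
    whiskL (invHom v.map) (v'.rightCell ≫ invCell v.rightCell) ≫
    (Bicategory.associator _ _ _).inv ≫ whiskR (counitCell v.map) M.right ≫
    (Bicategory.leftUnitor M.right).hom

/-- The 2-cell exhibiting an extension along an equivalence. -/
noncomputable def extendCell (v : Hom N M) (v' : Hom N M') [v.map.func.IsEquivalence] :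
    v.map ≫ (v.extend v').map ⟶ v'.map :=
  (Bicategory.associator _ _ _).inv ≫ whiskR (unitInvCell v.map) v'.map ≫
    (Bicategory.leftUnitor v'.map).hom

theorem extend_leftApp (v : Hom N M) (v' : Hom N M') [v.map.func.IsEquivalence]
    (m : M.apex.carrier) :
    (v.extend v').leftApp m = v'.leftApp (v.map.func.inv.obj m) ≫
      inv (v.leftApp (v.map.func.inv.obj m)) ≫
        M.left.func.map (counitApp v.map.func m) := by
  change 𝟙 _ ≫ (v'.leftApp _ ≫ inv (v.leftApp _)) ≫ 𝟙 _ ≫ M.left.func.map _ ≫ 𝟙 _ = _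
  simp only [Category.id_comp, Category.comp_id, Category.assoc]
  rfl

theorem extend_rightApp (v : Hom N M) (v' : Hom N M') [v.map.func.IsEquivalence]
    (m : M.apex.carrier) :
    (v.extend v').rightApp m = v'.rightApp (v.map.func.inv.obj m) ≫
      inv (v.rightApp (v.map.func.inv.obj m)) ≫
        M.right.func.map (counitApp v.map.func m) := by
  change 𝟙 _ ≫ (v'.rightApp _ ≫ inv (v.rightApp _)) ≫ 𝟙 _ ≫ M.right.func.map _ ≫ 𝟙 _ = _
  simp only [Category.id_comp, Category.comp_id, Category.assoc]
  rfl

theorem extendCell_app (v : Hom N M) (v' : Hom N M') [v.map.func.IsEquivalence]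
    (x : N.apex.carrier) :
    (v.extendCell v').nat.app x = v'.map.func.map (unitInvApp v.map.func x) :=
  (Category.id_comp _).trans (Category.comp_id _)

/-- Naturality of both left 2-cells at the unit, with the triangle identity turning the counit in
`extend_leftApp` into an image of the unit. -/
theorem extendCell_left (v : Hom N M) (v' : Hom N M') [v.map.func.IsEquivalence]
    (x : N.apex.carrier) :
    M'.left.func.map ((v.extendCell v').nat.app x) ≫ v'.leftApp x =
      (v.extend v').leftApp (v.map.func.obj x) ≫ v.leftApp x := by
  rw [extendCell_app, extend_leftApp]
  refine (v'.leftApp_naturality (unitInvApp v.map.func x)).trans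
    (Eq.trans ?_ (Category.assoc _ _ _).symm)
  refine congrArg (v'.leftApp (v.map.func.inv.obj (v.map.func.obj x)) ≫ ·) ?_
  rw [Category.assoc, ← map_unitInvApp, leftApp_naturality,
    IsIso.inv_hom_id_assoc]

theorem extendCell_right (v : Hom N M) (v' : Hom N M') [v.map.func.IsEquivalence]
    (x : N.apex.carrier) :
    M'.right.func.map ((v.extendCell v').nat.app x) ≫ v'.rightApp x =
      (v.extend v').rightApp (v.map.func.obj x) ≫ v.rightApp x := by
  rw [extendCell_app, extend_rightApp]
  refine (v'.rightApp_naturality (unitInvApp v.map.func x)).trans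
    (Eq.trans ?_ (Category.assoc _ _ _).symm)
  refine congrArg (v'.rightApp (v.map.func.inv.obj (v.map.func.obj x)) ≫ ·) ?_
  rw [Category.assoc, ← map_unitInvApp, rightApp_naturality,
    IsIso.inv_hom_id_assoc]

theorem extend_isEquivalence (v : Hom N M) (v' : Hom N M') [v.map.func.IsEquivalence]
    [v'.map.func.IsEquivalence] : (v.extend v').IsEquivalence :=
  inferInstanceAs (v.map.func.inv ⋙ v'.map.func).IsEquivalence

end PSpan.Hom

/-- A 2-cell between morphisms of spans from a natural transformation compatible with the left
2-cells and the right 2-cells: the compatibility with parities is automatic. -/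
noncomputable def PSpan.Hom₂.mk' {S T : ParityGroupoid.{u}} {M N : PSpan S T} {v w : PSpan.Hom M N}
    (δ : v.map.func ⟶ w.map.func)
    (left : ∀ x, N.left.func.map (δ.app x) ≫ w.leftApp x = v.leftApp x)
    (right : ∀ x, N.right.func.map (δ.app x) ≫ w.rightApp x = v.rightApp x) :
    PSpan.Hom₂ v w where
  cell := ParityGroupoid.Hom₂.mk δ fun x => by
    -- The cells of the left leg are invertible and both morphisms respect them, so the cell of the
    -- apex map is determined by the left leg.
    have h := cell_naturality N.left (δ.app x)
    rw [← cancel_mono (N.left.cell.app (w.map.func.obj x) ≫ S.par.map (w.leftApp x)),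
      w.leftApp_compat, ← v.leftApp_compat, ← left, Functor.map_comp, Category.assoc,
      reassoc_of% h]
  left := left
  right := right

/-! ### Uniqueness: any two factorizations are equivalent. -/

namespace InvariantSpan

variable {G : Type} [Group G] [Finite G] {S W : ParityGroupoid.{u}} {a : PAction G S}
  {A : InvariantSpan a W} {M M' : PSpan (weakQuotient a) W}

namespace Hom

variable (φ : Hom A ((ofQuotientMap a).comp M)) (φ' : Hom A ((ofQuotientMap a).comp M'))

theorem fstLeftInv_fstLeft (x : A.apex.carrier) : φ.fstLeftInv x ≫ φ.fstLeft x = 𝟙 _ :=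
  IsIso.inv_hom_id (φ.fstLeft x)

theorem fstLeft_fstLeftInv (x : A.apex.carrier) : φ.fstLeft x ≫ φ.fstLeftInv x = 𝟙 _ :=
  IsIso.hom_inv_id (φ.fstLeft x)

theorem fstLeftInv_naturality {x y : A.apex.carrier} (f : x ⟶ y) :
    A.left.func.map f ≫ φ.fstLeftInv y = φ.fstLeftInv x ≫ φ.fstMap f := by
  unfold fstLeftInv
  rw [IsIso.comp_inv_eq, Category.assoc, fstLeft_naturality, IsIso.inv_hom_id_assoc]

theorem fstLeftInv_fstEquiv (g : G) (x : A.apex.carrier) :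
    φ.fstLeftInv ((A.action.act g).func.obj x) ≫ φ.fstEquiv g x =
      A.equivariance.app g x ≫ (a.act g).func.map (φ.fstLeftInv x) := by
  unfold fstLeftInv
  rw [IsIso.inv_comp_eq, Functor.map_inv, ← reassoc_of% (φ.fstEquiv_left g x), IsIso.hom_inv_id,
    Category.comp_id]

theorem descLeft_fstLeftInv_arrow (x : A.apex.carrier) :
    φ.descLeft x ≫ (quotientMap a).func.map (φ.fstLeftInv x) ≫ φ.arrow x = 𝟙 _ := by
  unfold descLeft
  rw [Category.assoc, ← Functor.map_comp_assoc, fstLeft_fstLeftInv, CategoryTheory.Functor.map_id,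
    Category.id_comp, IsIso.inv_hom_id]

theorem arrow_descLeft (x : A.apex.carrier) :
    φ.arrow x ≫ φ.descLeft x = (quotientMap a).func.map (φ.fstLeft x) :=
  IsIso.hom_inv_id_assoc _ _

/-- This is the commuting square that makes the pair of components in `factorCell` an arrow of the
pullback. -/
theorem fstLeft_fstLeftInv_arrow (w : PSpan.Hom M M') {x : A.apex.carrier}
    {η : w.map.func.obj (φ.sndObj x) ⟶ φ'.sndObj x}
    (h : M'.left.func.map η ≫ φ'.descLeft x = w.leftApp (φ.sndObj x) ≫ φ.descLeft x) :
    (quotientMap a).func.map (φ.fstLeft x ≫ φ'.fstLeftInv x) ≫ φ'.arrow x =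
      (φ.arrow x ≫ inv (w.leftApp (φ.sndObj x))) ≫ M'.left.func.map η := by
  rw [Functor.map_comp, Category.assoc, ← arrow_descLeft, Category.assoc, Category.assoc]
  congr 1
  rw [IsIso.eq_inv_comp, ← reassoc_of% h, descLeft_fstLeftInv_arrow, Category.comp_id]

theorem fstLeft_fstLeftInv_compat (x : A.apex.carrier) :
    φ.map.cell.app x ≫ S.par.map (φ.fstLeft x ≫ φ'.fstLeftInv x) = φ'.map.cell.app x :=
  (congrArg (φ.map.cell.app x ≫ ·) (S.par.map_comp _ _)).trans
    ((Category.assoc _ _ _).symm.trans ((congrArg (· ≫ S.par.map (φ'.fstLeftInv x))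
      (φ.fstLeft_compat x)).trans (φ'.fstLeftInv_compat x)))

/-- A 2-cell over `A/G` yields a compatibility 2-cell of morphisms into composites with the
quotient map. -/
noncomputable def factorCell (w : PSpan.Hom M M') (h : φ.descMap ≫ w.map ⟶ φ'.descMap)
    (hl : ∀ x : A.apex.carrier,
      M'.left.func.map (h.nat.app ((quotientMap A.action).func.obj x)) ≫ φ'.descLeft x =
        w.leftApp (φ.sndObj x) ≫ φ.descLeft x)
    (hr : ∀ x : A.apex.carrier,
      M'.right.func.map (h.nat.app ((quotientMap A.action).func.obj x)) ≫ φ'.sndRight x =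
        w.rightApp (φ.sndObj x) ≫ φ.sndRight x) :
    Hom₂ (φ.comp ((ofQuotientMap a).compMap w)) φ' where
  cell := mkCell (F := φ.map ≫ ((ofQuotientMap a).compMap w).map)
    -- The first component is the only arrow compatible with the two left 2-cells.
    (fun x => ⟨φ.fstLeft x ≫ φ'.fstLeftInv x, h.nat.app ((quotientMap A.action).func.obj x),
      φ.fstLeft_fstLeftInv_arrow φ' w (hl x)⟩)
    (fun {x y} f => CommaMorphism.ext
      (by
        change φ.fstMap f ≫ φ.fstLeft y ≫ φ'.fstLeftInv y =
          (φ.fstLeft x ≫ φ'.fstLeftInv x) ≫ φ'.fstMap f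
        rw [reassoc_of% (φ.fstLeft_naturality f), fstLeftInv_naturality, Category.assoc])
      (by
        have := h.nat.naturality ((quotientMap A.action).func.map f)
        change w.map.func.map (φ.descMap.func.map _) ≫ _ = _ ≫ φ'.descMap.func.map _ at this
        rw [descMap_map_quotientMap, descMap_map_quotientMap] at this
        exact this))
    (fun x => by
      change (φ.map.cell.app x ≫ 𝟙 _) ≫ S.par.map (φ.fstLeft x ≫ φ'.fstLeftInv x) =
        φ'.map.cell.app x
      rw [Category.comp_id, fstLeft_fstLeftInv_compat])
  left x := by
    change (φ.fstLeft x ≫ φ'.fstLeftInv x) ≫ φ'.fstLeft x = 𝟙 _ ≫ φ.fstLeft x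
    rw [Category.assoc, fstLeftInv_fstLeft, Category.comp_id, Category.id_comp]
  right x := hr x
  comm g x := CommaMorphism.ext
    (by
      change (φ.fstLeft _ ≫ φ'.fstLeftInv _) ≫ φ'.fstEquiv g x =
        (φ.fstEquiv g x ≫ 𝟙 _) ≫ (a.act g).func.map (φ.fstLeft x ≫ φ'.fstLeftInv x)
      rw [Category.comp_id, Functor.map_comp, reassoc_of% (φ.fstEquiv_left g x), Category.assoc,
        fstLeftInv_fstEquiv])
    (by
      -- Equivariance of the second component is naturality of `h` along the new arrow.
      have := h.nat.naturality ((quotientMapInvariance A.action).app g x)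
      change w.map.func.map (φ.descMap.func.map _) ≫ _ = _ ≫ φ'.descMap.func.map _ at this
      rw [descMap_map_app, descMap_map_app] at this
      refine this.symm.trans ?_
      exact congrArg (· ≫ h.nat.app ((quotientMap A.action).func.obj x))
        (Category.comp_id (w.map.func.map (φ.sndEquiv g x))).symm)

end Hom

/-- Two factorizations through the quotient map are equivalent. -/
noncomputable def Factorization.equivalence (F F' : Factorization (ofQuotientMap a) A) :
    Factorization.Equivalence F F' :=
  have := F.hom.descMap_isEquivalence F.isEquivalence
  have := F'.hom.descMap_isEquivalence F'.isEquivalence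
  have : F.hom.descHom.map.func.IsEquivalence := ‹F.hom.descMap.func.IsEquivalence›
  have : F'.hom.descHom.map.func.IsEquivalence := ‹F'.hom.descMap.func.IsEquivalence›
  -- Both spans receive an equivalence from `A/G`; one is extended along the other.
  { hom := F.hom.descHom.extend F'.hom.descHom
    isEquivalence := F.hom.descHom.extend_isEquivalence F'.hom.descHom
    cell := F.hom.factorCell F'.hom _ (F.hom.descHom.extendCell F'.hom.descHom)
      (fun x => F.hom.descHom.extendCell_left F'.hom.descHom
        ((quotientMap A.action).func.obj x))
      (fun x => F.hom.descHom.extendCell_right F'.hom.descHom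
        ((quotientMap A.action).func.obj x)) }

/-! ### Uniqueness: a unique 2-cell between two equivalences of factorizations. -/

namespace Factorization.Equivalence

variable {F F' : Factorization (ofQuotientMap a) A} (e e' : Factorization.Equivalence F F')

/-- The first component of the compatibility 2-cell. -/
noncomputable def fstApp (x : A.apex.carrier) : F.hom.fstObj x ⟶ F'.hom.fstObj x :=
  (e.cell.cell.nat.app x).left

/-- The second component of the compatibility 2-cell. -/
noncomputable def sndApp (x : A.apex.carrier) :
    e.hom.map.func.obj (F.hom.sndObj x) ⟶ F'.hom.sndObj x :=
  (e.cell.cell.nat.app x).right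

theorem fstApp_fstLeft (x : A.apex.carrier) :
    e.fstApp x ≫ F'.hom.fstLeft x = F.hom.fstLeft x :=
  (e.cell.left x).trans (Category.id_comp _)

theorem sndApp_sndRight (x : A.apex.carrier) :
    F'.span.right.func.map (e.sndApp x) ≫ F'.hom.sndRight x =
      e.hom.rightApp (F.hom.sndObj x) ≫ F.hom.sndRight x :=
  e.cell.right x

theorem fstApp_arrow (x : A.apex.carrier) :
    (quotientMap a).func.map (e.fstApp x) ≫ F'.hom.arrow x =
      F.hom.arrow x ≫ inv (e.hom.leftApp (F.hom.sndObj x)) ≫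
        F'.span.left.func.map (e.sndApp x) :=
  (e.cell.cell.nat.app x).w.trans (Category.assoc _ _ _)

theorem sndApp_naturality {x y : A.apex.carrier} (f : x ⟶ y) :
    e.hom.map.func.map (F.hom.sndMap f) ≫ e.sndApp y = e.sndApp x ≫ F'.hom.sndMap f :=
  congrArg CommaMorphism.right (e.cell.cell.nat.naturality f)

theorem sndApp_sndEquiv (g : G) (x : A.apex.carrier) :
    e.hom.map.func.map (F.hom.sndEquiv g x) ≫ e.sndApp x =
      e.sndApp ((A.action.act g).func.obj x) ≫ F'.hom.sndEquiv g x :=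
  ((congrArg (· ≫ e.sndApp x)
    (Category.comp_id (e.hom.map.func.map (F.hom.sndEquiv g x)))).symm.trans
      (congrArg CommaMorphism.right (e.cell.comm g x)).symm)

/-- The left 2-cells leave no freedom in the first component, so two equivalences differ only in
their second components. -/
theorem fstApp_eq (x : A.apex.carrier) : e.fstApp x = e'.fstApp x := by
  rw [← cancel_mono (F'.hom.fstLeft x), fstApp_fstLeft, fstApp_fstLeft]

/-- The comparison of the second components of two compatibility 2-cells. -/
noncomputable def compare (x : A.apex.carrier) :
    e.hom.map.func.obj (F.hom.sndObj x) ⟶ e'.hom.map.func.obj (F.hom.sndObj x) :=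
  e.sndApp x ≫ inv (e'.sndApp x)

theorem compare_sndMap {x y : A.apex.carrier} (f : x ⟶ y) :
    e.hom.map.func.map (F.hom.sndMap f) ≫ compare e e' y =
      compare e e' x ≫ e'.hom.map.func.map (F.hom.sndMap f) := by
  unfold compare
  rw [reassoc_of% (e.sndApp_naturality f), Category.assoc]
  congr 1
  rw [IsIso.comp_inv_eq, Category.assoc, e'.sndApp_naturality, IsIso.inv_hom_id_assoc]

theorem compare_sndEquiv (g : G) (x : A.apex.carrier) :
    e.hom.map.func.map (F.hom.sndEquiv g x) ≫ compare e e' x =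
      compare e e' ((A.action.act g).func.obj x) ≫
        e'.hom.map.func.map (F.hom.sndEquiv g x) := by
  unfold compare
  rw [reassoc_of% (e.sndApp_sndEquiv g x), Category.assoc]
  congr 1
  rw [IsIso.comp_inv_eq, Category.assoc, e'.sndApp_sndEquiv, IsIso.inv_hom_id_assoc]

/-- The pullback squares express the left 2-cells through first and second components. Since the
first components agree, the squares can be compared and the invertible connecting arrow cancelled.
-/
theorem compare_left (x : A.apex.carrier) :
    F'.span.left.func.map (compare e e' x) ≫ e'.hom.leftApp (F.hom.sndObj x) =
      e.hom.leftApp (F.hom.sndObj x) := by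
  have h := e.fstApp_arrow x
  rw [fstApp_eq e e', e'.fstApp_arrow, cancel_epi, eq_comm, IsIso.inv_comp_eq] at h
  unfold compare
  rw [Functor.map_comp, Functor.map_inv, h]
  simp only [Category.assoc, IsIso.hom_inv_id_assoc, IsIso.inv_hom_id, Category.comp_id]

theorem compare_right (x : A.apex.carrier) :
    F'.span.right.func.map (compare e e' x) ≫ e'.hom.rightApp (F.hom.sndObj x) =
      e.hom.rightApp (F.hom.sndObj x) := by
  unfold compare
  rw [← cancel_mono (F.hom.sndRight x), Category.assoc, ← e.sndApp_sndRight,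
    ← e'.sndApp_sndRight, Functor.map_comp, Functor.map_inv, Category.assoc,
    IsIso.inv_hom_id_assoc]

/-- The natural transformation on `A/G` comparing two equivalences of factorizations. -/
noncomputable def compareTrans :
    F.hom.descMap.func ⋙ e.hom.map.func ⟶ F.hom.descMap.func ⋙ e'.hom.map.func where
  app x := compare e e' x.pt
  naturality x y r := weakQuotient_naturality A.action
    (F := F.hom.descMap.func ⋙ e.hom.map.func) (H := F.hom.descMap.func ⋙ e'.hom.map.func)
    (fun x => compare e e' x)
    (fun {x y} f =>
      (congrArg (fun r => e.hom.map.func.map r ≫ compare e e' y)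
        (F.hom.descMap_map_quotientMap f)).trans ((compare_sndMap e e' f).trans
          (congrArg (fun r => compare e e' x ≫ e'.hom.map.func.map r)
            (F.hom.descMap_map_quotientMap f).symm)))
    (fun g x =>
      (congrArg (fun r => e.hom.map.func.map r ≫ compare e e' x)
        (F.hom.descMap_map_app g x)).trans ((compare_sndEquiv e e' g x).trans
          (congrArg (fun r => compare e e' _ ≫ e'.hom.map.func.map r)
            (F.hom.descMap_map_app g x).symm))) (x := x.pt) (y := y.pt) r

/-- Compatibility forces the 2-cell on the second components of points of `A`, and these exhaust
`F.span` up to isomorphism. -/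
theorem Hom.app_sndObj {e e' : Factorization.Equivalence F F'} (δ : Equivalence.Hom e e')
    (x : A.apex.carrier) :
    δ.cell.cell.nat.app (F.hom.sndObj x) = compare e e' x := by
  unfold compare
  rw [IsIso.eq_comp_inv]
  exact congrArg CommaMorphism.right (δ.comm x)

theorem Hom.ext' {e e' : Factorization.Equivalence F F'} {δ δ' : Equivalence.Hom e e'}
    (h : ∀ m, δ.cell.cell.nat.app m = δ'.cell.cell.nat.app m) : δ = δ' := by
  obtain ⟨⟨c, _, _⟩, _⟩ := δ
  obtain ⟨⟨c', _, _⟩, _⟩ := δ'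
  obtain rfl : c = c' := hom₂_ext h
  rfl

theorem subsingleton_hom : Subsingleton (Equivalence.Hom e e') where
  allEq δ δ' := by
    have := F.hom.descMap_isEquivalence F.isEquivalence
    refine Hom.ext' fun m => congrFun (congrArg NatTrans.app
      (natTrans_ext_of_essSurj F.hom.descMap.func
        (α := δ.cell.cell.nat) (β := δ'.cell.cell.nat) fun x => ?_)) m
    exact (δ.app_sndObj x.pt).trans (δ'.app_sndObj x.pt).symm

/-- The transformation `compareTrans` lives on `A/G` and extends along the equivalence `A/G ≃
F.span`. Compatibility with the legs is an equality of natural transformations, so it may be tested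
on the image of `A/G`. -/
theorem nonempty_hom : Nonempty (Equivalence.Hom e e') := by
  have := F.hom.descMap_isEquivalence F.isEquivalence
  obtain ⟨δ, hδ⟩ := exists_natTrans_extension F.hom.descMap.func (compareTrans e e')
  have hδ' (x : A.apex.carrier) : δ.app (F.hom.sndObj x) = compare e e' x :=
    hδ ((quotientMap A.action).func.obj x)
  refine ⟨⟨PSpan.Hom₂.mk' δ (fun m => ?_) (fun m => ?_), fun x => CommaMorphism.ext ?_ ?_⟩⟩
  · refine congrFun (congrArg NatTrans.app (natTrans_ext_of_essSurj F.hom.descMap.func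
      (α := Functor.whiskerRight δ F'.span.left.func ≫ e'.hom.leftCell.nat)
      (β := e.hom.leftCell.nat) fun x => ?_)) m
    exact (congrArg (fun r => F'.span.left.func.map r ≫ _) (hδ' x.pt)).trans
      (compare_left e e' x.pt)
  · refine congrFun (congrArg NatTrans.app (natTrans_ext_of_essSurj F.hom.descMap.func
      (α := Functor.whiskerRight δ F'.span.right.func ≫ e'.hom.rightCell.nat)
      (β := e.hom.rightCell.nat) fun x => ?_)) m
    exact (congrArg (fun r => F'.span.right.func.map r ≫ _) (hδ' x.pt)).trans
      (compare_right e e' x.pt)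
  -- The first component of the induced 2-cell is an identity, so what remains is the agreement of
  -- first components.
  · exact (Category.id_comp (e'.fstApp x)).trans (fstApp_eq e' e x)
  · refine (congrArg (· ≫ e'.sndApp x) (hδ' x)).trans ?_
    unfold compare
    rw [Category.assoc, IsIso.inv_hom_id, Category.comp_id]
    rfl

end Factorization.Equivalence

theorem ofQuotientMap_isUniversal (a : PAction G S) : (ofQuotientMap a).IsUniversal :=
  fun _ A => ⟨⟨⟨A.quotient, A.toCompQuotient, A.toCompQuotient_isEquivalence⟩⟩,
    fun F F' => ⟨⟨F.equivalence F'⟩, fun e e' =>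
      have := Factorization.Equivalence.subsingleton_hom e e'
      ⟨⟨⟨(Factorization.Equivalence.nonempty_hom e e').some⟩, fun _ => Subsingleton.elim _ _⟩⟩⟩⟩

end InvariantSpan

end ParityLin

/-- By definition `qShriek X k` is the quotient span of the signed action, so the general statements
apply with `G` the symmetric group; the signs are carried by the parity cells of that action. -/
theorem mainTheorem6 (X : ParityLin.ParityGroupoid.{u}) (k : ℕ) :
    (ParityLin.qShriek X k).IsUniversal ∧
    ∀ (W : ParityLin.ParityGroupoid.{u}) (A : ParityLin.AlternatingSpan X k W),
      ∃ φ : ParityLin.InvariantSpan.Hom A ((ParityLin.qShriek X k).comp A.quotient),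
        φ.IsEquivalence ∧
        Nonempty (φ.map ≫ ParityLin.pullbackSnd (ParityLin.qShriek X k).right A.quotient.left ⟶
          ParityLin.quotientMap A.action) :=
  ⟨ParityLin.InvariantSpan.ofQuotientMap_isUniversal (ParityLin.signedAction X k),
    fun _ A => ⟨A.toCompQuotient, A.toCompQuotient_isEquivalence, ⟨A.toCompQuotientSnd⟩⟩⟩
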